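/- Let $n,m,\ell$ be positive integers; all manifolds are $C^\infty$, Hausdorff, second countable and without boundary. Let $N$ be a manifold of dimension $n$, let $U\subset\mathbb{R}^m$ be open, let $f:N\to U$ be a $C^\infty$ immersion and let $F:U\to\mathbb{R}^\ell$ be a $C^\infty$ mapping. For a linear mapping $\pi:\mathbb{R}^m\to\mathbb{R}^\ell$ put $F_\pi=F+\pi|_U$. Let $J^1(n,\ell)$ be the space of $1$-jets $j^1g(0)$ of map germs $g:(\mathbb{R}^n,0)\to(\mathbb{R}^\ell,0)$. A subset $X\subset J^1(n,\ell)$ is called $\mathcal{A}^1$-invariant if $j^1g(0)\in X$ implies $j^1(H\circ g\circ h^{-1})(0)\in X$ for all germs of diffeomorphisms $H:(\mathbb{R}^\ell,0)\to(\mathbb{R}^\ell,0)$ and $h:(\mathbb{R}^n,0)\to(\mathbb{R}^n,0)$. Let $J^1(N,\mathbb{R}^\ell)$ be the manifold of $1$-jets of mappings $N\to\mathbb{R}^\ell$. Each chart $(U_\lambda,\varphi_\lambda)$ of $N$ gives the chart $$\Phi_\lambda(j^1g(q))=\bigl(\varphi_\lambda(q),\,g(q),\,j^1(t\mapsto g(\varphi_\lambda^{-1}(\varphi_\lambda(q)+t))-g(q))(0)\bigr)$$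 of $J^1(N,\mathbb{R}^\ell)$ over $U_\lambda$, with values in $\varphi_\lambda(U_\lambda)\times\mathbb{R}^\ell\times J^1(n,\ell)$. For $X\subset J^1(n,\ell)$ put $$X(N,\mathbb{R}^\ell)=\bigcup_\lambda\Phi_\lambda^{-1}\bigl(\varphi_\lambda(U_\lambda)\times\mathbb{R}^\ell\times X\bigr)\subset J^1(N,\mathbb{R}^\ell),$$ the union being over an atlas of $N$. Theorem. Let $X$ be an $\mathcal{A}^1$-invariant (embedded) submanifold of dimension $d$ of $J^1(n,\ell)$. Then $X(N,\mathbb{R}^\ell)$ is a submanifold of dimension $n+\ell+d$ of $J^1(N,\mathbb{R}^\ell)$ (so it has the same codimension as $X$), and there is a subset $\Sigma$ of Lebesgue measure zero of the space $\mathcal{L}(\mathbb{R}^m,\mathbb{R}^\ell)=(\mathbb{R}^m)^\ell$ of linear mappings such that for every $\pi\in\mathcal{L}(\mathbb{R}^m,\mathbb{R}^\ell)\setminus\Sigma$ the mapping $j^1(F_\pi\circ f):N\to J^1(N,\mathbb{R}^\ell)$, $q\mapsto j^1(F_\pi\circ f)(q)$, is transverse to $X(N,\mathbb{R}^\ell)$;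 that is, with $g=j^1(F_\pi\circ f)$, for every $q\in N$ with $g(q)\in X(N,\mathbb{R}^\ell)$, $$dg_q(T_qN)+T_{g(q)}X(N,\mathbb{R}^\ell)=T_{g(q)}J^1(N,\mathbb{R}^\ell).$$ -/

import Mathlib

open scoped Manifold ContDiff Topology

noncomputable section

/-! ### Submanifolds, tangent spaces of submanifolds, transversality -/

section Transversality

variable {E H M E' H' P : Type*}
  [NormedAddCommGroup E] [NormedSpace ℝ E] [TopologicalSpace H]
  [TopologicalSpace M] [ChartedSpace H M]
  [NormedAddCommGroup E'] [NormedSpace ℝ E'] [TopologicalSpace H']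
  [TopologicalSpace P] [ChartedSpace H' P]

/-- `W` is a (smooth, embedded) submanifold of dimension `d` of the boundaryless manifold `P`:
around each point of `W` there is a smooth chart `e` of `P`, with values in the model vector space,
in which `W` is the trace of a `d`-dimensional linear subspace. -/
def IsSubmanifold (J : ModelWithCorners ℝ E' H') (d : ℕ) (W : Set P) : Prop :=
  ∀ p ∈ W, ∃ e : OpenPartialHomeomorph P E', p ∈ e.source ∧
    ContMDiffOn J 𝓘(ℝ, E') ∞ e e.source ∧
    ContMDiffOn 𝓘(ℝ, E') J ∞ e.symm e.target ∧
    ∃ S : Submodule ℝ E', Module.finrank ℝ S = d ∧ ∀ x ∈ e.source, (x ∈ W ↔ e x ∈ S)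

/-- The tangent space `T_p W ⊆ T_p P` of a submanifold `W` of `P`: the space of the velocities at
time `0` of the smooth curves that lie in `W` and pass through `p` at time `0`.
(For a submanifold these velocities already form a linear subspace; the span only records this
in the type.) -/
def submanifoldTangentSpace (J : ModelWithCorners ℝ E' H') (W : Set P) (p : P) :
    Submodule ℝ (TangentSpace J p) :=
  Submodule.span ℝ {v : TangentSpace J p | ∃ γ : ℝ → P, γ 0 = p ∧
    (∀ᶠ t in 𝓝 (0 : ℝ), ContMDiffAt 𝓘(ℝ, ℝ) J ∞ γ t ∧ γ t ∈ W) ∧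
    mfderiv 𝓘(ℝ, ℝ) J γ 0 (1 : ℝ) = v}

/-- `g` is transverse to `W`: whenever `g q ∈ W`,
`dg_q (T_q M) + T_{g q} W = T_{g q} P`. -/
def IsTransverseTo (I : ModelWithCorners ℝ E H) (J : ModelWithCorners ℝ E' H')
    (g : M → P) (W : Set P) : Prop :=
  ∀ q : M, g q ∈ W →
    LinearMap.range (mfderiv I J g q).toLinearMap ⊔ submanifoldTangentSpace J W (g q) = ⊤

/-- `f` is an immersion: it is smooth and its differential is injective at every point. -/
def IsSmoothImmersion (I : ModelWithCorners ℝ E H) (J : ModelWithCorners ℝ E' H')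
    (f : M → P) : Prop :=
  ContMDiff I J ∞ f ∧ ∀ q : M, Function.Injective (mfderiv I J f q)

end Transversality

/-! ### 1-jets of map germs `(ℝⁿ, 0) → (ℝˡ, 0)` -/

/-- `J¹(n, l)`, the space of 1-jets at `0` of map germs `(ℝⁿ, 0) → (ℝˡ, 0)`. Such a jet is the
differential of the germ at `0`, and every linear map occurs: `j¹g(0)` is `fderiv ℝ g 0`. -/
abbrev JetSpace (n l : ℕ) : Type :=
  EuclideanSpace ℝ (Fin n) →L[ℝ] EuclideanSpace ℝ (Fin l)

/-- `h` represents a germ of diffeomorphisms `(ℝᵏ, 0) → (ℝᵏ, 0)`. -/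
def IsDiffeoGermAtZero {k : ℕ}
    (h : OpenPartialHomeomorph (EuclideanSpace ℝ (Fin k)) (EuclideanSpace ℝ (Fin k))) : Prop :=
  (0 : EuclideanSpace ℝ (Fin k)) ∈ h.source ∧ h 0 = 0 ∧
    ContDiffOn ℝ ∞ h h.source ∧ ContDiffOn ℝ ∞ h.symm h.target

/-- `X ⊆ J¹(n, l)` is `𝒜¹`-invariant: if `j¹g(0) ∈ X`, then `j¹(H ∘ g ∘ h⁻¹)(0) ∈ X` for all germs
of diffeomorphisms `H` of `(ℝˡ, 0)` and `h` of `(ℝⁿ, 0)`. -/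
def IsA1Invariant {n l : ℕ} (X : Set (JetSpace n l)) : Prop :=
  ∀ (g : EuclideanSpace ℝ (Fin n) → EuclideanSpace ℝ (Fin l))
    (H : OpenPartialHomeomorph (EuclideanSpace ℝ (Fin l)) (EuclideanSpace ℝ (Fin l)))
    (h : OpenPartialHomeomorph (EuclideanSpace ℝ (Fin n)) (EuclideanSpace ℝ (Fin n))),
    (∀ᶠ x in 𝓝 0, ContDiffAt ℝ ∞ g x) → g 0 = 0 →
    IsDiffeoGermAtZero H → IsDiffeoGermAtZero h →
    fderiv ℝ g 0 ∈ X → fderiv ℝ (H ∘ g ∘ h.symm) 0 ∈ X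

/-! ### The jet bundle `J¹(N, ℝˡ)` -/

section JetBundle

variable (n l : ℕ) (N : Type*) [TopologicalSpace N] [ChartedSpace (EuclideanSpace ℝ (Fin n)) N]
  [IsManifold (𝓡 n) ∞ N]

/-- The vector bundle `Hom(TN, ℝˡ)` over `N`, with Mathlib's manifold structure. -/
abbrev HomTangentBundle : Type _ :=
  Bundle.TotalSpace (EuclideanSpace ℝ (Fin n) →L[ℝ] EuclideanSpace ℝ (Fin l))
    (fun q : N => TangentSpace (𝓡 n) q →L[ℝ] Bundle.Trivial N (EuclideanSpace ℝ (Fin l)) q)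

/-- `J¹(N, ℝˡ)`, the manifold of 1-jets of maps `N → ℝˡ`. The 1-jet at `q` of a map `g` is
determined by `q`, the value `y = g q` and the differential `A = dg_q : T_q N → ℝˡ`, and all
triples `(q, y, A)` occur; the triple is recorded as `(y, ⟨q, A⟩)`. -/
abbrev JetBundle : Type _ := EuclideanSpace ℝ (Fin l) × HomTangentBundle n l N

/-- The model with corners of the manifold `J¹(N, ℝˡ)`, with model vector space
`ℝˡ × (ℝⁿ × J¹(n, l))`. -/
abbrev jetModel := (𝓡 l).prod ((𝓡 n).prod 𝓘(ℝ, JetSpace n l))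

variable {n l N}

/-- The map `j¹g : N → J¹(N, ℝˡ)`, sending `q` to the 1-jet of `g` at `q`. -/
def jetExtension (g : N → EuclideanSpace ℝ (Fin l)) (q : N) : JetBundle n l N :=
  (g q, ⟨q, mfderiv (𝓡 n) (𝓡 l) g q⟩)

/-- The coordinate map `Φ_φ` of `J¹(N, ℝˡ)` given by a chart `φ` of `N` (to be used over
`φ.source`). It sends the jet at `q` of `g` to `φ q`, `g q` and the jet at `0` of the map
`t ↦ g (φ⁻¹ (φ q + t)) - g q`, which is the linear map `dg_q ∘ d(φ⁻¹)_{φ q}`. -/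
def jetCoord (φ : OpenPartialHomeomorph N (EuclideanSpace ℝ (Fin n))) (j : JetBundle n l N) :
    EuclideanSpace ℝ (Fin n) × EuclideanSpace ℝ (Fin l) × JetSpace n l :=
  let A : EuclideanSpace ℝ (Fin n) →L[ℝ] EuclideanSpace ℝ (Fin l) := j.2.snd
  let B : EuclideanSpace ℝ (Fin n) →L[ℝ] EuclideanSpace ℝ (Fin n) :=
    mfderiv (𝓡 n) (𝓡 n) φ.symm (φ j.2.proj)
  (φ j.2.proj, j.1, A.comp B)

variable (N) in
/-- `X(N, ℝˡ) = ⋃_φ Φ_φ⁻¹ (φ(U_φ) × ℝˡ × X)`, where `(U_φ, φ)` runs over the atlas of `N` and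
`Φ_φ` is defined over `U_φ`. -/
def subfibreBundle (X : Set (JetSpace n l)) : Set (JetBundle n l N) :=
  ⋃ φ ∈ atlas (EuclideanSpace ℝ (Fin n)) N,
    {j | j.2.proj ∈ φ.source ∧ jetCoord φ j ∈ φ.target ×ˢ (Set.univ ×ˢ X)}

end JetBundle

/-! ### Null sets of linear maps -/

/-- A set of linear maps `ℝᵐ → ℝˡ` has Lebesgue measure zero, under the natural identification of
the space of linear maps with `(ℝᵐ)ˡ` by matrix entries. -/
def IsLebesgueNull {m l : ℕ}
    (S : Set (EuclideanSpace ℝ (Fin m) →ₗ[ℝ] EuclideanSpace ℝ (Fin l))) : Prop :=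
  MeasureTheory.volume {a : Fin l → Fin m → ℝ | Matrix.toEuclideanLin (Matrix.of a) ∈ S} = 0

end

/-! In a chart of `N` with coordinate x, the fibre coordinate of the jet of F_π ∘ f is a(x) + π ∘
b(x), where a and b are the derivatives of F ∘ f and f read in the chart. As f is an immersion, b(x)
has a left inverse, so π ↦ π ∘ b(x) is onto the space of jets: the family is a submersion in the
parameter π alone. Parametric transversality then makes it transverse to X for almost every π,
locally in (x, π), and second countability leaves only countably many null sets to unite.

A change of chart acts on the fibre coordinate by composition with a linear isomorphism, so
invariance makes X(N, ℝˡ) the full product over each chart. It is therefore a submanifold, its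
tangent spaces contain all base and value directions, and only transversality of the fibre
coordinate to X is at stake (`range_mfderiv_jetExtension_sup_eq_top`).

Parametric transversality (`exists_nhds_measure_not_regular_eq_zero`) projects the zero set of h(x,
p) to the parameter space: a regular value p of this projection makes 0 a regular value of h(·, p).
Almost every p is regular by Sard's theorem (`sardInDimension`), proved by induction on the
dimension of the source. -/

open MeasureTheory

universe u

/-! ### Inverse function theorem, straightening and Taylor estimates -/

section Calculus

/-- Surjectivity of L means that L ∘ R is invertible for some R, and invertibility is an open
condition. -/
theorem ContinuousLinearMap.isOpen_setOf_surjective {E F : Type*}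
    [NormedAddCommGroup E] [NormedSpace ℝ E]
    [NormedAddCommGroup F] [NormedSpace ℝ F] [FiniteDimensional ℝ F] :
    IsOpen {L : E →L[ℝ] F | Function.Surjective L} := by
  have key : {L : E →L[ℝ] F | Function.Surjective L} =
      ⋃ R : F →L[ℝ] E, (fun L : E →L[ℝ] F => L.comp R) ⁻¹' {A : F →L[ℝ] F | IsUnit A} := by
    ext L
    simp only [Set.mem_ofPred_eq, Set.mem_iUnion, Set.mem_preimage]
    constructor
    · intro hL
      obtain ⟨R, hR⟩ := (L : E →ₗ[ℝ] F).exists_rightInverse_of_surjective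
        (LinearMap.range_eq_top.2 hL)
      refine ⟨LinearMap.toContinuousLinearMap R, ?_⟩
      have : L.comp (LinearMap.toContinuousLinearMap R) = 1 := by
        ext x
        exact LinearMap.congr_fun hR x
      rw [this]
      exact isUnit_one
    · rintro ⟨R, u, hu⟩ y
      refine ⟨R ((↑u⁻¹ : F →L[ℝ] F) y), ?_⟩
      have h1 : (u : F →L[ℝ] F) * (↑u⁻¹ : F →L[ℝ] F) = 1 := u.mul_inv
      rw [hu] at h1
      exact DFunLike.congr_fun h1 y
  rw [key]
  refine isOpen_iUnion fun R => Units.isOpen.preimage ?_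
  exact continuous_id.clm_comp continuous_const

/-- The inverse function theorem, with smoothness of the local inverse on a whole neighbourhood. -/
theorem exists_openPartialHomeomorph_of_bijective_fderiv {E F : Type*}
    [NormedAddCommGroup E] [NormedSpace ℝ E] [FiniteDimensional ℝ E]
    [NormedAddCommGroup F] [NormedSpace ℝ F] [FiniteDimensional ℝ F]
    {g : E → F} {x₀ : E} (hg : ∀ᶠ x in 𝓝 x₀, ContDiffAt ℝ ∞ g x)
    (h : Function.Bijective (fderiv ℝ g x₀)) :
    ∃ e : OpenPartialHomeomorph E F, x₀ ∈ e.source ∧ (∀ x, e x = g x) ∧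
      ∀ y ∈ e.target, ContDiffAt ℝ ∞ e.symm y := by
  have : CompleteSpace E := FiniteDimensional.complete ℝ E
  have : CompleteSpace F := FiniteDimensional.complete ℝ F
  let L : E ≃L[ℝ] F := ContinuousLinearEquiv.ofBijective (fderiv ℝ g x₀)
    (LinearMap.ker_eq_bot.2 h.1) (LinearMap.range_eq_top.2 h.2)
  have hL : (L : E →L[ℝ] F) = fderiv ℝ g x₀ := by ext; rfl
  have hg0 : ContDiffAt ℝ ∞ g x₀ := hg.self_of_nhds
  have hd : HasFDerivAt g (L : E →L[ℝ] F) x₀ := by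
    rw [hL]
    exact (hg0.differentiableAt (by simp)).hasFDerivAt
  let e₀ := hg0.toOpenPartialHomeomorph g hd (by simp)
  have he₀ : (e₀ : E → F) = g := hg0.toOpenPartialHomeomorph_coe hd (by simp)
  have hopen : IsOpen (Set.range ((↑) : (E ≃L[ℝ] F) → E →L[ℝ] F)) := ContinuousLinearEquiv.isOpen
  -- Invertibility of the derivative persists near `x₀`. Restricting to an open set `s` where it
  -- holds makes the local inverse smooth at every point of its domain.
  have hev : ∀ᶠ x in 𝓝 x₀, ContDiffAt ℝ ∞ g x ∧
      fderiv ℝ g x ∈ Set.range ((↑) : (E ≃L[ℝ] F) → E →L[ℝ] F) := by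
    refine hg.and ?_
    have hc : ContinuousAt (fderiv ℝ g) x₀ := (hg0.fderiv_right (m := 0) (by simp)).continuousAt
    exact hc.eventually_mem (hopen.mem_nhds ⟨L, hL⟩)
  obtain ⟨s, hs, hso, hxs⟩ := eventually_nhds_iff.1 hev
  refine ⟨e₀.restr s, ?_, ?_, ?_⟩
  · rw [e₀.restr_source' s hso]
    exact ⟨hg0.mem_toOpenPartialHomeomorph_source hd (by simp), hxs⟩
  · intro x
    exact congrFun he₀ x
  · intro y hy
    have hx : (e₀.restr s).symm y ∈ (e₀.restr s).source := (e₀.restr s).map_target hy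
    rw [e₀.restr_source' s hso] at hx
    obtain ⟨hc, L', hL'⟩ := hs _ hx.2
    have hcoe : ((e₀.restr s : OpenPartialHomeomorph E F) : E → F) = g := he₀
    refine (e₀.restr s).contDiffAt_symm (f₀' := L') hy ?_ ?_
    · rw [hcoe, hL']
      exact (hc.differentiableAt (by simp)).hasFDerivAt
    · rw [hcoe]
      exact hc

/-- A function with non-zero differential at a point is a linear coordinate in a smooth chart. -/
theorem exists_straightening {E : Type*} [NormedAddCommGroup E] [NormedSpace ℝ E]
    [FiniteDimensional ℝ E] {w : E → ℝ} {x₀ : E} (hw : ∀ᶠ x in 𝓝 x₀, ContDiffAt ℝ ∞ w x)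
    (h : fderiv ℝ w x₀ ≠ 0) :
    ∃ K : Submodule ℝ E, Module.finrank ℝ K + 1 = Module.finrank ℝ E ∧
      ∃ e : OpenPartialHomeomorph E (K × ℝ), x₀ ∈ e.source ∧ (∀ x, (e x).2 = w x) ∧
        ∀ y ∈ e.target, ContDiffAt ℝ ∞ e.symm y := by
  have hw0 : ContDiffAt ℝ ∞ w x₀ := hw.self_of_nhds
  set A : E →L[ℝ] ℝ := fderiv ℝ w x₀ with hA
  obtain ⟨v, hv⟩ : ∃ v, A v = 1 := by
    obtain ⟨u, hu⟩ : ∃ u, A u ≠ 0 := by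
      by_contra! hc
      exact h (ContinuousLinearMap.ext hc)
    exact ⟨(A u)⁻¹ • u, by simp [hu]⟩
  let R : ℝ →L[ℝ] E := ContinuousLinearMap.toSpanSingleton ℝ v
  have hR : Function.RightInverse R A := fun t => by simp [R, hv]
  -- Projection onto ker A along v. The chart is (pr, w): its derivative (pr, A) is bijective
  -- because E = ker A ⊕ ℝv.
  let pr := A.projKerOfRightInverse R hR
  have hpr : ∀ x, ((pr x : LinearMap.ker (A : E →ₗ[ℝ] ℝ)) : E) = x - A x • v := fun x => rfl
  refine ⟨LinearMap.ker (A : E →ₗ[ℝ] ℝ), ?_, ?_⟩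
  · have h1 := LinearMap.finrank_range_add_finrank_ker (A : E →ₗ[ℝ] ℝ)
    have h2 : LinearMap.range (A : E →ₗ[ℝ] ℝ) = ⊤ :=
      LinearMap.range_eq_top.2 fun t => ⟨t • v, by simp [hv]⟩
    rw [h2, finrank_top, Module.finrank_self] at h1
    omega
  · have hg : ∀ᶠ x in 𝓝 x₀, ContDiffAt ℝ ∞ (fun x => (pr x, w x)) x :=
      hw.mono fun x hx => pr.contDiff.contDiffAt.prodMk hx
    have hfd : fderiv ℝ (fun x => (pr x, w x)) x₀ = pr.prod A :=
      (pr.hasFDerivAt.prodMk (hw0.differentiableAt (by simp)).hasFDerivAt).fderiv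
    have hbij : Function.Bijective (fderiv ℝ (fun x => (pr x, w x)) x₀) := by
      rw [hfd]
      constructor
      · rw [injective_iff_map_eq_zero]
        intro x hx
        have h1 : pr x = 0 := congrArg Prod.fst hx
        have h2 : A x = 0 := congrArg Prod.snd hx
        have h3 := hpr x
        rw [h1, h2] at h3
        simpa using h3.symm
      · rintro ⟨k, t⟩
        have hk : A (k : E) = 0 := k.2
        refine ⟨(k : E) + t • v, Prod.ext (Subtype.ext ?_) ?_⟩
        · change ((pr ((k : E) + t • v) : LinearMap.ker (A : E →ₗ[ℝ] ℝ)) : E) = k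
          rw [hpr]
          simp [hk, hv]
        · change A ((k : E) + t • v) = t
          simp [hk, hv]
    obtain ⟨e, hx, he, ht⟩ := exists_openPartialHomeomorph_of_bijective_fderiv hg hbij
    exact ⟨e, hx, fun x => by rw [he], ht⟩

/-- If the derivatives of orders `1, …, k` of `f` vanish at `x`, then `f y - f x` is
`O(‖y - x‖ ^ (k + 1))`, with constant a bound of the derivative of order `k + 1`. -/
theorem Convex.norm_image_sub_le_of_iteratedFDeriv_eq_zero {E : Type u}
    [NormedAddCommGroup E] [NormedSpace ℝ E] {s : Set E} (hs : Convex ℝ s) {x : E} (hx : x ∈ s)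
    {M : ℝ} (k : ℕ) : ∀ {F : Type u} [NormedAddCommGroup F] [NormedSpace ℝ F] {f : E → F},
    (∀ y ∈ s, ContDiffAt ℝ ∞ f y) → (∀ y ∈ s, ‖iteratedFDeriv ℝ (k + 1) f y‖ ≤ M) →
    (∀ i, 1 ≤ i → i ≤ k → iteratedFDeriv ℝ i f x = 0) →
    ∀ y ∈ s, ‖f y - f x‖ ≤ M * ‖y - x‖ ^ (k + 1) := by
  induction k with
  | zero =>
    intro F _ _ f hf hM _ y hy
    have := hs.norm_image_sub_le_of_norm_fderiv_le (𝕜 := ℝ) (f := f) (C := M)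
      (fun z hz => (hf z hz).differentiableAt (by simp))
      (fun z hz => by
        have h1 := hM z hz
        rwa [← norm_iteratedFDeriv_fderiv, norm_iteratedFDeriv_zero] at h1) hx hy
    simpa using this
  | succ k ih =>
    intro F _ _ f hf hM h0 y hy
    have h1 : ∀ z ∈ s, ‖fderiv ℝ f z - fderiv ℝ f x‖ ≤ M * ‖z - x‖ ^ (k + 1) := by
      -- The induction hypothesis is applied to the derivative of f, with values in E →L F; hence
      -- the target varies in the induction and shares the universe of E.
      refine ih (fun z hz => (hf z hz).fderiv_right (m := ∞) (by simp)) ?_ ?_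
      · intro z hz
        rw [norm_iteratedFDeriv_fderiv]
        exact hM z hz
      · intro i hi hik
        rw [← norm_eq_zero, norm_iteratedFDeriv_fderiv, norm_eq_zero]
        exact h0 (i + 1) (by omega) (by omega)
    have h2 : fderiv ℝ f x = 0 := by
      rw [← norm_eq_zero, ← norm_iteratedFDeriv_zero (𝕜 := ℝ) (f := fderiv ℝ f),
        norm_iteratedFDeriv_fderiv, norm_eq_zero]
      exact h0 1 le_rfl (by omega)
    have hM0 : 0 ≤ M := (norm_nonneg _).trans (hM x hx)
    have hseg : segment ℝ x y ⊆ s := hs.segment_subset hx hy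
    -- On the segment, unlike on all of s, ‖z - x‖ ≤ ‖y - x‖, which gives a constant bound for the
    -- derivative.
    have := (convex_segment x y).norm_image_sub_le_of_norm_fderiv_le (𝕜 := ℝ) (f := f)
      (C := M * ‖y - x‖ ^ (k + 1))
      (fun z hz => (hf z (hseg hz)).differentiableAt (by simp))
      (fun z hz => by
        have h3 := h1 z (hseg hz)
        rw [h2, sub_zero] at h3
        refine h3.trans ?_
        gcongr
        rw [← dist_eq_norm, ← dist_eq_norm]
        have := dist_add_dist_of_mem_segment hz
        have h5 : dist z y ≥ 0 := dist_nonneg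
        rw [dist_comm z x, dist_comm y x]
        linarith)
      (left_mem_segment ℝ x y) (right_mem_segment ℝ x y)
    rw [pow_succ, ← mul_assoc]
    exact this

end Calculus

/-! ### Sard's theorem -/

section Sard

/-- Countably many of the neighbourhoods cover C. No measurability is needed, since outer measure is
countably subadditive. -/
theorem measure_image_eq_zero_of_locally {E F : Type*} [TopologicalSpace E]
    [SecondCountableTopology E] [MeasurableSpace F] {μ : Measure F} {f : E → F} {C : Set E}
    (h : ∀ x ∈ C, ∃ u ∈ 𝓝 x, μ (f '' (C ∩ u)) = 0) : μ (f '' C) = 0 := by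
  choose! u hu hμ using h
  obtain ⟨t, htC, htc, hCt⟩ := TopologicalSpace.countable_cover_nhdsWithin (f := u) (s := C)
    fun x hx => mem_nhdsWithin_of_mem_nhds (hu x hx)
  refine measure_mono_null (t := ⋃ x ∈ t, f '' (C ∩ u x)) ?_
    ((measure_biUnion_null_iff htc).2 fun x hx => hμ x (htC hx))
  rintro _ ⟨x, hx, rfl⟩
  obtain ⟨y, hy, hxy⟩ := Set.mem_iUnion₂.1 (hCt hx)
  exact Set.mem_iUnion₂.2 ⟨y, hy, x, ⟨hx, hxy⟩, rfl⟩

variable {E F : Type u} [NormedAddCommGroup E] [NormedSpace ℝ E] [FiniteDimensional ℝ E]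
  [NormedAddCommGroup F] [NormedSpace ℝ F] [FiniteDimensional ℝ F]
  [MeasurableSpace F] [BorelSpace F]

/-- A map sends a set of points at which it is sufficiently flat to a null set. -/
theorem exists_nhds_measure_image_flat_eq_zero (μ : Measure F) [μ.IsAddHaarMeasure]
    (hF : 0 < Module.finrank ℝ F) {k : ℕ} (hk : Module.finrank ℝ E ≤ k) {f : E → F} {x₀ : E}
    (hf : ∀ᶠ x in 𝓝 x₀, ContDiffAt ℝ ∞ f x) {C : Set E}
    (hC : ∀ x ∈ C, ∀ i, 1 ≤ i → i ≤ k → iteratedFDeriv ℝ i f x = 0) :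
    ∃ u ∈ 𝓝 x₀, μ (f '' (C ∩ u)) = 0 := by
  obtain ⟨r, hr, hball⟩ := Metric.nhds_basis_closedBall.eventually_iff.1 hf
  have hcont : ContinuousOn (fun y => ‖iteratedFDeriv ℝ (k + 1) f y‖)
      (Metric.closedBall x₀ r) := fun y hy =>
    ((hball hy).continuousAt_iteratedFDeriv
      (by exact_mod_cast le_top)).norm.continuousWithinAt
  have : ProperSpace E := FiniteDimensional.proper ℝ E
  obtain ⟨M, hM⟩ := (isCompact_closedBall x₀ r).bddAbove_image hcont
  have hM' : ∀ y ∈ Metric.closedBall x₀ r, ‖iteratedFDeriv ℝ (k + 1) f y‖ ≤ M :=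
    fun y hy => hM ⟨y, hy, rfl⟩
  have hM0 : 0 ≤ M := (norm_nonneg _).trans (hM' x₀ (Metric.mem_closedBall_self hr.le))
  refine ⟨Metric.closedBall x₀ r, Metric.closedBall_mem_nhds x₀ hr, ?_⟩
  -- Every point of C may serve as the centre of the Taylor estimate, so f is Hölder on C with
  -- exponent k + 1.
  have hH : HolderOnWith M.toNNReal ((k + 1 : ℕ) : NNReal) f (C ∩ Metric.closedBall x₀ r) := by
    intro x hx y hy
    have h1 := (convex_closedBall x₀ r).norm_image_sub_le_of_iteratedFDeriv_eq_zero hy.2 k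
      (fun z hz => hball hz) hM' (hC y hy.1) x hx.2
    rw [edist_dist, edist_dist, dist_eq_norm, dist_eq_norm]
    rw [NNReal.coe_natCast, ENNReal.rpow_natCast, ← ENNReal.ofReal_pow (norm_nonneg _)]
    rw [← ENNReal.ofReal, ← ENNReal.ofReal_mul hM0]
    exact ENNReal.ofReal_le_ofReal h1
  -- The Hausdorff dimension of the image is at most k / (k + 1) < 1 ≤ dim F.
  have hdim : dimH (f '' (C ∩ Metric.closedBall x₀ r)) <
      ((Module.finrank ℝ F : NNReal) : ENNReal) := by
    refine (hH.dimH_image_le (by positivity)).trans_lt ?_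
    have h1 : dimH (C ∩ Metric.closedBall x₀ r) ≤ (k : ENNReal) :=
      (dimH_mono (Set.subset_univ _)).trans (by
        rw [Real.dimH_univ_eq_finrank]
        exact_mod_cast hk)
    refine lt_of_lt_of_le (b := 1) ?_ (by exact_mod_cast hF)
    rw [ENNReal.div_lt_iff (Or.inl (by simp)) (Or.inl (by simp)), one_mul]
    refine h1.trans_lt ?_
    simp only [ENNReal.coe_natCast]
    exact_mod_cast Nat.lt_succ_self k
  refine measure_zero_of_dimH_lt (d := (Module.finrank ℝ F : NNReal)) ?_ hdim
  rw [NNReal.coe_natCast]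
  exact Measure.absolutelyContinuous_isAddHaarMeasure μ _

/-- A compact set whose slices by the level sets of a linear functional are null is null. -/
theorem IsCompact.measure_eq_zero_of_slices (μ : Measure F) [μ.IsAddHaarMeasure] {A : Set F}
    (hA : IsCompact A) (lam : F →L[ℝ] ℝ) {v : F} (hv : lam v = 1)
    (h : ∀ t : ℝ, (Measure.addHaar : Measure (LinearMap.ker (lam : F →ₗ[ℝ] ℝ)))
      {z | (z : F) + t • v ∈ A} = 0) : μ A = 0 := by
  let K := LinearMap.ker (lam : F →ₗ[ℝ] ℝ)
  let R : ℝ →L[ℝ] F := ContinuousLinearMap.toSpanSingleton ℝ v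
  have hR : Function.RightInverse R lam := fun t => by simp [R, hv]
  let T : F ≃L[ℝ] ℝ × K := ContinuousLinearEquiv.equivOfRightInverse lam R hR
  have hT : ∀ (t : ℝ) (z : K), T.symm (t, z) = (z : F) + t • v := fun t z => by
    rw [ContinuousLinearEquiv.equivOfRightInverse_symm_apply]
    simp [R, add_comm]
  have : CompleteSpace F := FiniteDimensional.complete ℝ F
  -- Compactness serves to make the image closed, hence measurable, as Fubini and the push-forward
  -- require.
  have hTA : IsCompact (T '' A) := hA.image T.continuous
  let ν : Measure (ℝ × K) := (volume : Measure ℝ).prod Measure.addHaar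
  have h0 : ν (T '' A) = 0 := by
    refine (Measure.measure_prod_null hTA.isClosed.measurableSet).2
      (Filter.Eventually.of_forall fun t => ?_)
    refine (congrArg _ ?_).trans (h t)
    ext z
    change (t, z) ∈ T '' A ↔ (z : F) + t • v ∈ A
    rw [← hT t z]
    constructor
    · rintro ⟨a, ha, hta⟩
      rwa [← hta, T.symm_apply_apply]
    · intro hz
      exact ⟨_, hz, T.apply_symm_apply _⟩
  have hac : Measure.map T μ ≪ ν := by
    have : (Measure.map T μ).IsAddHaarMeasure := T.isAddHaarMeasure_map μ
    exact Measure.absolutelyContinuous_isAddHaarMeasure _ _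
  have h1 := hac h0
  rw [Measure.map_apply T.continuous.measurable hTA.isClosed.measurableSet,
    T.injective.preimage_image] at h1
  exact h1

/-- The assertion of Sard's theorem for maps whose source has dimension `n`. -/
def SardInDimension (n : ℕ) : Prop :=
  ∀ {E F : Type u} [NormedAddCommGroup E] [NormedSpace ℝ E] [FiniteDimensional ℝ E]
    [NormedAddCommGroup F] [NormedSpace ℝ F] [FiniteDimensional ℝ F]
    [MeasurableSpace F] [BorelSpace F] (μ : Measure F) [μ.IsAddHaarMeasure]
    {V : Set E} {f : E → F}, Module.finrank ℝ E = n → IsOpen V →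
    (∀ x ∈ V, ContDiffAt ℝ ∞ f x) →
    μ (f '' {x ∈ V | ¬ Function.Surjective (fderiv ℝ f x)}) = 0

/-- Some functional λ has d(λ ∘ f) ≠ 0, so λ ∘ f can be taken as a coordinate. Then f maps level
sets of this coordinate to level sets of λ, and a critical point of f is critical for the
restriction to its level set. The induction hypothesis makes each slice of the critical values null,
and Fubini concludes. -/
theorem exists_nhds_measure_image_critical_eq_zero_of_fderiv_ne_zero
    (ih : ∀ m < Module.finrank ℝ E, SardInDimension.{u} m)
    (μ : Measure F) [μ.IsAddHaarMeasure] {V : Set E} {f : E → F} (hV : IsOpen V)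
    (hf : ∀ x ∈ V, ContDiffAt ℝ ∞ f x) {x₀ : E} (hx₀ : x₀ ∈ V) (h0 : fderiv ℝ f x₀ ≠ 0) :
    ∃ u ∈ 𝓝 x₀, μ (f '' ({x ∈ V | ¬ Function.Surjective (fderiv ℝ f x)} ∩ u)) = 0 := by
  have : ProperSpace E := FiniteDimensional.proper ℝ E
  have hdiff : ∀ x ∈ V, DifferentiableAt ℝ f x := fun x hx => (hf x hx).differentiableAt (by simp)
  obtain ⟨a, ha⟩ : ∃ a, fderiv ℝ f x₀ a ≠ 0 := by
    by_contra! hc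
    exact h0 (ContinuousLinearMap.ext hc)
  obtain ⟨lam, hlam⟩ := SeparatingDual.exists_ne_zero (R := ℝ) ha
  obtain ⟨v, hv⟩ : ∃ v, lam v = 1 := ⟨(lam (fderiv ℝ f x₀ a))⁻¹ • fderiv ℝ f x₀ a, by simp [hlam]⟩
  have hw : ∀ᶠ x in 𝓝 x₀, ContDiffAt ℝ ∞ (fun x => lam (f x)) x := by
    filter_upwards [hV.mem_nhds hx₀] with x hx
    exact lam.contDiff.contDiffAt.comp x (hf x hx)
  have hw0 : fderiv ℝ (fun x => lam (f x)) x₀ ≠ 0 := by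
    have h1 : fderiv ℝ (fun x => lam (f x)) x₀ = lam.comp (fderiv ℝ f x₀) :=
      (lam.hasFDerivAt.comp x₀ (hdiff x₀ hx₀).hasFDerivAt).fderiv
    rw [h1]
    intro h2
    exact hlam (DFunLike.congr_fun h2 a)
  obtain ⟨K, hK, e, hxe, he2, het⟩ := exists_straightening hw hw0
  obtain ⟨B, hB, hBV, hBc⟩ := local_compact_nhds
    (Filter.inter_mem (hV.mem_nhds hx₀) (e.open_source.mem_nhds hxe))
  refine ⟨B, hB, ?_⟩
  let Kl := LinearMap.ker (lam : F →ₗ[ℝ] ℝ)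
  let R : ℝ →L[ℝ] F := ContinuousLinearMap.toSpanSingleton ℝ v
  have hR : Function.RightInverse R lam := fun t => by simp [R, hv]
  let P : F →L[ℝ] Kl := lam.projKerOfRightInverse R hR
  have hP : ∀ z, (P z : F) = z - lam z • v := fun z => rfl
  -- Criticality is a closed condition, so the critical points in the compact set B have a compact
  -- image, as the slicing lemma demands.
  have hcl : IsClosed (B ∩ fderiv ℝ f ⁻¹' {L : E →L[ℝ] F | Function.Surjective L}ᶜ) := by
    refine ContinuousOn.preimage_isClosed_of_isClosed ?_ hBc.isClosed
      ContinuousLinearMap.isOpen_setOf_surjective.isClosed_compl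
    intro x hx
    exact ((hf x (hBV hx).1).fderiv_right (m := 0) (by simp)).continuousAt.continuousWithinAt
  have hset : {x ∈ V | ¬ Function.Surjective (fderiv ℝ f x)} ∩ B =
      B ∩ fderiv ℝ f ⁻¹' {L : E →L[ℝ] F | Function.Surjective L}ᶜ := by
    ext x
    constructor
    · rintro ⟨⟨_, h2⟩, h3⟩
      exact ⟨h3, h2⟩
    · rintro ⟨h1, h2⟩
      exact ⟨⟨(hBV h1).1, h2⟩, h1⟩
  rw [hset]
  have hcomp : IsCompact (f '' (B ∩ fderiv ℝ f ⁻¹' {L : E →L[ℝ] F | Function.Surjective L}ᶜ)) :=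
    (hBc.of_isClosed_subset hcl Set.inter_subset_left).image_of_continuousOn
      fun x hx => (hf x (hBV hx.1).1).continuousAt.continuousWithinAt
  refine hcomp.measure_eq_zero_of_slices μ lam hv fun t => ?_
  let V' : Set K := (fun k : K => (k, t)) ⁻¹' (e.target ∩ e.symm ⁻¹' V)
  have hV' : IsOpen V' := (e.isOpen_inter_preimage_symm hV).preimage (by fun_prop)
  let g : K → Kl := fun k => P (f (e.symm (k, t)))
  have hfe : ∀ k ∈ V', ContDiffAt ℝ ∞ (fun y => f (e.symm y)) (k, t) := fun k hk =>
    (hf _ hk.2).comp (k, t) (het _ hk.1)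
  have hg : ∀ k ∈ V', ContDiffAt ℝ ∞ g k := fun k hk => by
    have hin : ContDiffAt ℝ ∞ (fun k : K => (k, t)) k := contDiffAt_id.prodMk contDiffAt_const
    exact P.contDiff.contDiffAt.comp k
      (ContDiffAt.comp (g := fun y : K × ℝ => f (e.symm y)) k (hfe k hk) hin)
  refine measure_mono_null ?_ (ih (Module.finrank ℝ K) (by omega) Measure.addHaar (f := g) rfl
    hV' hg)
  rintro z ⟨x, ⟨hxB, hxc⟩, hxz⟩
  have hxV := (hBV hxB).1
  have hxs := (hBV hxB).2
  have hlz : lam (z : F) = 0 := z.2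
  have hex : e x = ((e x).1, t) := by
    refine Prod.ext rfl ?_
    rw [he2]
    change lam (f x) = t
    rw [hxz]
    simp [hlz, hv]
  have hsymm : e.symm ((e x).1, t) = x := by rw [← hex, e.left_inv hxs]
  have hkV : (e x).1 ∈ V' := by
    refine ⟨?_, ?_⟩
    · change ((e x).1, t) ∈ e.target
      rw [← hex]
      exact e.map_source hxs
    · change e.symm ((e x).1, t) ∈ V
      rwa [hsymm]
  refine ⟨(e x).1, ⟨hkV, fun hsurj => hxc ?_⟩, ?_⟩
  · set k := (e x).1
    set D := fderiv ℝ (fun y => f (e.symm y)) (k, t) with hD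
    have hDd : HasFDerivAt (fun y => f (e.symm y)) D (k, t) :=
      ((hfe k hkV).differentiableAt (by simp)).hasFDerivAt
    have hsd : HasFDerivAt e.symm (fderiv ℝ e.symm (k, t)) (k, t) :=
      ((het _ hkV.1).differentiableAt (by simp)).hasFDerivAt
    have hfx : HasFDerivAt f (fderiv ℝ f x) (e.symm (k, t)) := by
      rw [hsymm]
      exact (hdiff x hxV).hasFDerivAt
    have hDc : D = (fderiv ℝ f x).comp (fderiv ℝ e.symm (k, t)) :=
      hDd.unique (hfx.comp (k, t) hsd)
    have hgd : fderiv ℝ g k = (P.comp D).comp (ContinuousLinearMap.inl ℝ K ℝ) := by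
      have hin : HasFDerivAt (fun k : K => (k, t)) (ContinuousLinearMap.inl ℝ K ℝ) k :=
        (hasFDerivAt_id k).prodMk (hasFDerivAt_const t k)
      exact (P.hasFDerivAt.comp k (HasFDerivAt.comp k hDd hin)).fderiv
    have hlD : ∀ y, lam (D y) = y.2 := by
      intro y
      have h1 : HasFDerivAt (fun y => lam (f (e.symm y))) (lam.comp D) (k, t) :=
        lam.hasFDerivAt.comp _ hDd
      have h2 : HasFDerivAt (fun y : K × ℝ => lam (f (e.symm y))) (ContinuousLinearMap.snd ℝ K ℝ)
          (k, t) := by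
        refine (ContinuousLinearMap.snd ℝ K ℝ).hasFDerivAt.congr_of_eventuallyEq ?_
        filter_upwards [e.open_target.mem_nhds hkV.1] with y hy
        have h3 := he2 (e.symm y)
        rw [e.right_inv hy] at h3
        exact h3.symm
      exact DFunLike.congr_fun (h1.unique h2) y
    -- Since λ(D(0, 1)) = 1, subtracting λ(z) D(0, 1) moves z into ker λ. There the assumed
    -- surjectivity of dg supplies a preimage (κ, 0), and P does not alter D(κ, 0), on which λ
    -- vanishes.
    have hDs : Function.Surjective D := by
      intro z
      have hz' : lam (z - lam z • D (0, 1)) = 0 := by simp [hlD]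
      obtain ⟨κ, hκ⟩ := hsurj ⟨z - lam z • D (0, 1), hz'⟩
      rw [hgd] at hκ
      have h4 := congrArg Subtype.val hκ
      change (P (D (κ, 0)) : F) = z - lam z • D (0, 1) at h4
      rw [hP, hlD] at h4
      refine ⟨(κ, 0) + lam z • (0, 1), ?_⟩
      rw [map_add, map_smul]
      simp only [zero_smul, sub_zero] at h4
      rw [h4]
      abel
    rw [hDc] at hDs
    exact Function.Surjective.of_comp hDs
  · change P (f (e.symm ((e x).1, t))) = z
    rw [hsymm]
    refine Subtype.ext ?_
    rw [hP, hxz]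
    simp [hlz, hv]

/-- A component of the derivative of order i vanishes on C and has nonzero differential at `x₀`, so
near `x₀` the set C lies in a smooth hypersurface. As df = 0 on C, its points are critical for the
restriction of f to that hypersurface, whose dimension is smaller. -/
theorem exists_nhds_measure_image_eq_zero_of_iteratedFDeriv_ne_zero
    (ih : ∀ m < Module.finrank ℝ E, SardInDimension.{u} m)
    (μ : Measure F) [μ.IsAddHaarMeasure] (hF : 0 < Module.finrank ℝ F)
    {V : Set E} {f : E → F} (hV : IsOpen V)
    (hf : ∀ x ∈ V, ContDiffAt ℝ ∞ f x) {x₀ : E} (hx₀ : x₀ ∈ V) {i : ℕ} (hi : 1 ≤ i)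
    (h0 : iteratedFDeriv ℝ (i + 1) f x₀ ≠ 0) {C : Set E} (hCV : C ⊆ V)
    (hC : ∀ x ∈ C, ∀ j, 1 ≤ j → j ≤ i → iteratedFDeriv ℝ j f x = 0) :
    ∃ u ∈ 𝓝 x₀, μ (f '' (C ∩ u)) = 0 := by
  have hsm : ∀ x ∈ V, ContDiffAt ℝ ∞ (iteratedFDeriv ℝ i f) x := fun x hx =>
    (hf x hx).iteratedFDeriv_right (by exact_mod_cast le_top)
  obtain ⟨a, ha⟩ : ∃ a, fderiv ℝ (iteratedFDeriv ℝ i f) x₀ a ≠ 0 := by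
    by_contra! hc
    refine h0 (ContinuousMultilinearMap.ext fun m => ?_)
    rw [iteratedFDeriv_succ_apply_left, hc]
    rfl
  obtain ⟨lam, hlam⟩ := SeparatingDual.exists_ne_zero (R := ℝ) ha
  have hw : ∀ᶠ x in 𝓝 x₀, ContDiffAt ℝ ∞ (fun x => lam (iteratedFDeriv ℝ i f x)) x := by
    filter_upwards [hV.mem_nhds hx₀] with x hx
    exact lam.contDiff.contDiffAt.comp x (hsm x hx)
  have hw0 : fderiv ℝ (fun x => lam (iteratedFDeriv ℝ i f x)) x₀ ≠ 0 := by
    have h1 : fderiv ℝ (fun x => lam (iteratedFDeriv ℝ i f x)) x₀ =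
        lam.comp (fderiv ℝ (iteratedFDeriv ℝ i f) x₀) :=
      (lam.hasFDerivAt.comp x₀ ((hsm x₀ hx₀).differentiableAt (by simp)).hasFDerivAt).fderiv
    rw [h1]
    intro h2
    exact hlam (DFunLike.congr_fun h2 a)
  obtain ⟨K, hK, e, hxe, he2, het⟩ := exists_straightening hw hw0
  refine ⟨e.source, e.open_source.mem_nhds hxe, ?_⟩
  let V' : Set K := (fun k : K => (k, (0 : ℝ))) ⁻¹' (e.target ∩ e.symm ⁻¹' V)
  have hV' : IsOpen V' := (e.isOpen_inter_preimage_symm hV).preimage (by fun_prop)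
  let g : K → F := fun k => f (e.symm (k, 0))
  have hin : ∀ k ∈ V', ContDiffAt ℝ ∞ (fun k : K => e.symm (k, 0)) k := fun k hk =>
    (het _ hk.1).comp k (contDiffAt_id.prodMk contDiffAt_const)
  have hg : ∀ k ∈ V', ContDiffAt ℝ ∞ g k := fun k hk => (hf _ hk.2).comp k (hin k hk)
  refine measure_mono_null ?_ (ih (Module.finrank ℝ K) (by omega) μ (f := g) rfl hV' hg)
  rintro _ ⟨x, ⟨hxC, hxs⟩, rfl⟩
  have hxV := hCV hxC
  have hex : e x = ((e x).1, 0) := by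
    refine Prod.ext rfl ?_
    rw [he2, hC x hxC i hi le_rfl, map_zero]
  have hsymm : e.symm ((e x).1, 0) = x := by rw [← hex, e.left_inv hxs]
  have hkV : (e x).1 ∈ V' := by
    refine ⟨?_, ?_⟩
    · change ((e x).1, (0 : ℝ)) ∈ e.target
      rw [← hex]
      exact e.map_source hxs
    · change e.symm ((e x).1, 0) ∈ V
      rwa [hsymm]
  refine ⟨(e x).1, ⟨hkV, fun hsurj => ?_⟩, congrArg f hsymm⟩
  have hfx : fderiv ℝ f x = 0 := by
    rw [← norm_eq_zero, ← norm_iteratedFDeriv_zero (𝕜 := ℝ) (f := fderiv ℝ f),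
      norm_iteratedFDeriv_fderiv, norm_eq_zero]
    exact hC x hxC 1 le_rfl hi
  have hfd : HasFDerivAt f (0 : E →L[ℝ] F) (e.symm ((e x).1, 0)) := by
    rw [hsymm, ← hfx]
    exact ((hf x hxV).differentiableAt (by simp)).hasFDerivAt
  have hgd : fderiv ℝ g (e x).1 = 0 := by
    have := (hfd.comp (e x).1 ((hin _ hkV).differentiableAt (by simp)).hasFDerivAt).fderiv
    rw [ContinuousLinearMap.zero_comp] at this
    exact this
  rw [hgd] at hsurj
  have : Nontrivial F := Module.nontrivial_of_finrank_pos hF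
  obtain ⟨z, hz⟩ := exists_ne (0 : F)
  obtain ⟨y, hy⟩ := hsurj z
  exact hz hy.symm

/-- Critical points are sorted by the lowest order of a nonvanishing derivative. Order one is
treated by slicing, a higher order by passing to a hypersurface, and points flat to order n by the
Hausdorff dimension estimate. -/
theorem sardInDimension (n : ℕ) : SardInDimension.{u} n := by
  induction n using Nat.strong_induction_on with
  | _ n ih =>
  intro E F _ _ _ _ _ _ _ _ μ _ V f hn hV hf
  rcases Nat.eq_zero_or_pos (Module.finrank ℝ F) with hF | hF
  -- A map into a zero-dimensional space has no critical points; the other cases need dim F > 0.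
  · have : Subsingleton F := Module.finrank_zero_iff.1 hF
    have : {x ∈ V | ¬ Function.Surjective (fderiv ℝ f x)} = ∅ := by
      ext x
      simp [Function.surjective_to_subsingleton]
    rw [this]
    simp
  have ih' : ∀ m < Module.finrank ℝ E, SardInDimension.{u} m := fun m hm => ih m (hn ▸ hm)
  have hfd0 : ∀ x, fderiv ℝ f x = 0 → iteratedFDeriv ℝ 1 f x = 0 := fun x hx => by
    rw [← norm_eq_zero, ← norm_iteratedFDeriv_fderiv, norm_iteratedFDeriv_zero, hx, norm_zero]
  let C₀ : Set E := {x ∈ V | ¬ Function.Surjective (fderiv ℝ f x)} ∩ {x | fderiv ℝ f x ≠ 0}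
  let D : ℕ → Set E := fun i => {x ∈ V | 1 ≤ i ∧
    (∀ j, 1 ≤ j → j ≤ i → iteratedFDeriv ℝ j f x = 0) ∧ iteratedFDeriv ℝ (i + 1) f x ≠ 0}
  let Fl : Set E := {x ∈ V | ∀ j, 1 ≤ j → j ≤ n → iteratedFDeriv ℝ j f x = 0}
  have hcover : {x ∈ V | ¬ Function.Surjective (fderiv ℝ f x)} ⊆ C₀ ∪ (⋃ i, D i) ∪ Fl := by
    rintro x ⟨hxV, hxc⟩
    by_cases h0 : fderiv ℝ f x = 0
    · by_cases hfl : ∀ j, 1 ≤ j → j ≤ n → iteratedFDeriv ℝ j f x = 0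
      · exact Or.inr ⟨hxV, hfl⟩
      · left; right
        have hex : ∃ j, 1 ≤ j ∧ iteratedFDeriv ℝ j f x ≠ 0 := by
          push Not at hfl
          obtain ⟨j, h1, _, h2⟩ := hfl
          exact ⟨j, h1, h2⟩
        classical
        obtain ⟨hj1, hj2⟩ := Nat.find_spec hex
        have hmin : ∀ j, 1 ≤ j → j < Nat.find hex → iteratedFDeriv ℝ j f x = 0 := by
          intro j hj hjf
          by_contra hc
          exact Nat.find_min hex hjf ⟨hj, hc⟩
        have hne1 : Nat.find hex ≠ 1 := fun h => by
          rw [h] at hj2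
          exact hj2 (hfd0 x h0)
        obtain ⟨i, hi⟩ : ∃ i, Nat.find hex = i + 1 := ⟨Nat.find hex - 1, by omega⟩
        rw [hi] at hj2 hmin
        exact Set.mem_iUnion.2 ⟨i, hxV, by omega, fun j h1 h2 => hmin j h1 (by omega), hj2⟩
    · exact Or.inl (Or.inl ⟨⟨hxV, hxc⟩, h0⟩)
  refine measure_mono_null (Set.image_mono hcover) ?_
  rw [Set.image_union, Set.image_union, Set.image_iUnion]
  refine measure_union_null (measure_union_null ?_ (measure_iUnion_null fun i => ?_)) ?_
  · refine measure_image_eq_zero_of_locally fun x hx => ?_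
    obtain ⟨u, hu, h⟩ := exists_nhds_measure_image_critical_eq_zero_of_fderiv_ne_zero ih' μ hV hf
      hx.1.1 hx.2
    exact ⟨u, hu, measure_mono_null
      (Set.image_mono (Set.inter_subset_inter_left u Set.inter_subset_left)) h⟩
  · refine measure_image_eq_zero_of_locally fun x hx => ?_
    exact exists_nhds_measure_image_eq_zero_of_iteratedFDeriv_ne_zero ih' μ hF hV hf hx.1 hx.2.1
      hx.2.2.2 (fun y hy => hy.1) fun y hy => hy.2.2.1
  · refine measure_image_eq_zero_of_locally fun x hx => ?_
    exact exists_nhds_measure_image_flat_eq_zero μ hF hn.le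
      (Filter.eventually_of_mem (hV.mem_nhds hx.1) hf) fun y hy => hy.2

/-- **Sard's theorem**: the set of critical values of a smooth map is null. -/
theorem measure_image_critical_eq_zero (μ : Measure F) [μ.IsAddHaarMeasure] {V : Set E} {f : E → F}
    (hV : IsOpen V) (hf : ∀ x ∈ V, ContDiffAt ℝ ∞ f x) :
    μ (f '' {x ∈ V | ¬ Function.Surjective (fderiv ℝ f x)}) = 0 :=
  sardInDimension _ μ rfl hV hf

end Sard

/-! ### Parametric transversality -/

section ParametricTransversality

variable {E P Q : Type u} [NormedAddCommGroup E] [NormedSpace ℝ E] [FiniteDimensional ℝ E]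
  [NormedAddCommGroup P] [NormedSpace ℝ P] [FiniteDimensional ℝ P]
  [NormedAddCommGroup Q] [NormedSpace ℝ Q] [FiniteDimensional ℝ Q]

/-- Parametric transversality: if `h` is a submersion in the parameter `p` near `z₀`, then, locally,
`0` is a regular value of `h (·, p)` for almost every `p`. -/
theorem exists_nhds_measure_not_regular_eq_zero [MeasurableSpace P] [BorelSpace P]
    (μ : Measure P) [μ.IsAddHaarMeasure] {h : E × P → Q} {z₀ : E × P}
    (hh : ∀ᶠ z in 𝓝 z₀, ContDiffAt ℝ ∞ h z)
    (hs : Function.Surjective fun p => fderiv ℝ h z₀ (0, p)) :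
    ∃ O ∈ 𝓝 z₀, μ {p | ∃ x, (x, p) ∈ O ∧ h (x, p) = 0 ∧
      ¬ Function.Surjective fun v => fderiv ℝ h (x, p) (v, 0)} = 0 := by
  have hh0 : ContDiffAt ℝ ∞ h z₀ := hh.self_of_nhds
  set H := fderiv ℝ h z₀ with hH
  let A : P →L[ℝ] Q := H.comp (ContinuousLinearMap.inr ℝ E P)
  have hA : ∀ p, A p = H (0, p) := fun p => rfl
  obtain ⟨R₀, hR₀⟩ := (A : P →ₗ[ℝ] Q).exists_rightInverse_of_surjective
    (LinearMap.range_eq_top.2 hs)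
  let R : Q →L[ℝ] P := LinearMap.toContinuousLinearMap R₀
  have hR : Function.RightInverse R A := fun q => LinearMap.congr_fun hR₀ q
  let K := LinearMap.ker (A : P →ₗ[ℝ] Q)
  let pr : P →L[ℝ] K := A.projKerOfRightInverse R hR
  have hpr : ∀ p, (pr p : P) = p - R (A p) := fun p => rfl
  -- With A = ∂h/∂p onto and K = ker A, the map (x, p) ↦ ((x, pr p), h(x, p)) is a local
  -- diffeomorphism: pr sees p along K and h sees the complement.
  let prE : E × P →L[ℝ] E × K := (ContinuousLinearMap.id ℝ E).prodMap pr
  have hg : ∀ᶠ z in 𝓝 z₀, ContDiffAt ℝ ∞ (fun z => (prE z, h z)) z :=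
    hh.mono fun z hz => prE.contDiff.contDiffAt.prodMk hz
  have hfd : fderiv ℝ (fun z => (prE z, h z)) z₀ = prE.prod H :=
    (prE.hasFDerivAt.prodMk (hh0.differentiableAt (by simp)).hasFDerivAt).fderiv
  have hHadd : ∀ x p, H (x, p) = H (x, 0) + A p := fun x p => by
    rw [hA, ← map_add]
    simp
  have hbij : Function.Bijective (fderiv ℝ (fun z => (prE z, h z)) z₀) := by
    rw [hfd]
    constructor
    · rw [injective_iff_map_eq_zero]
      rintro ⟨x, p⟩ hx
      have h1 : x = 0 := congrArg (fun y => y.1.1) hx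
      have h2 : pr p = 0 := congrArg (fun y => y.1.2) hx
      have h3 : H (x, p) = 0 := congrArg Prod.snd hx
      have h4 := hpr p
      rw [h1, ← hA] at h3
      rw [h2, h3, map_zero, sub_zero] at h4
      rw [h1, ← h4]
      rfl
    · rintro ⟨⟨x, k⟩, q⟩
      have hk : A (k : P) = 0 := k.2
      have hAp : A ((k : P) + R (q - H (x, 0))) = q - H (x, 0) := by
        rw [map_add, hk, hR, zero_add]
      refine ⟨(x, (k : P) + R (q - H (x, 0))), Prod.ext (Prod.ext rfl (Subtype.ext ?_)) ?_⟩
      · change (pr ((k : P) + R (q - H (x, 0))) : P) = k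
        rw [hpr, hAp]
        abel
      · change H (x, (k : P) + R (q - H (x, 0))) = q
        rw [hHadd, hAp]
        abel
  obtain ⟨e, hze, he, het⟩ := exists_openPartialHomeomorph_of_bijective_fderiv hg hbij
  have hsub : ∀ᶠ z in 𝓝 z₀, ContDiffAt ℝ ∞ h z ∧
      Function.Surjective ((fderiv ℝ h z).comp (ContinuousLinearMap.inr ℝ E P)) := by
    refine hh.and ?_
    have hc : ContinuousAt (fun z => (fderiv ℝ h z).comp (ContinuousLinearMap.inr ℝ E P)) z₀ :=
      (hh0.fderiv_right (m := 0) (by simp)).continuousAt.clm_comp continuousAt_const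
    exact hc.eventually_mem (ContinuousLinearMap.isOpen_setOf_surjective.mem_nhds hs)
  refine ⟨_, Filter.inter_mem (e.open_source.mem_nhds hze) hsub, ?_⟩
  let V : Set (E × K) := (fun y : E × K => (y, (0 : Q))) ⁻¹' e.target
  have hV : IsOpen V := e.open_target.preimage (by fun_prop)
  -- The zero set of h is parametrized by E × K, and τ is its projection to the parameters. The bad
  -- p turn out to be critical values of τ.
  let τ : E × K → P := fun y => (e.symm (y, 0)).2
  have hin : ∀ y ∈ V, ContDiffAt ℝ ∞ (fun y : E × K => e.symm (y, 0)) y := fun y hy =>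
    ContDiffAt.comp y (het _ hy) (contDiffAt_id.prodMk contDiffAt_const)
  have hτ : ∀ y ∈ V, ContDiffAt ℝ ∞ τ y := fun y hy => contDiffAt_snd.comp y (hin y hy)
  refine measure_mono_null ?_ (measure_image_critical_eq_zero μ hV hτ)
  rintro p ⟨x, ⟨hxs, hxsm, hxsub⟩, hx0, hxc⟩
  have hex : e (x, p) = ((x, pr p), 0) := by
    rw [he, hx0]
    rfl
  have hyV : (x, pr p) ∈ V := by
    change ((x, pr p), (0 : Q)) ∈ e.target
    rw [← hex]
    exact e.map_source hxs
  have hsymm : e.symm ((x, pr p), 0) = (x, p) := by rw [← hex, e.left_inv hxs]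
  refine ⟨(x, pr p), ⟨hyV, fun hsurj => hxc ?_⟩, congrArg Prod.snd hsymm⟩
  set y : E × K := (x, pr p) with hy
  have hσ : HasFDerivAt (fun y : E × K => e.symm (y, 0))
      ((ContinuousLinearMap.fst ℝ E K).prod (fderiv ℝ τ y)) y := by
    have h1 : HasFDerivAt (fun y : E × K => (y.1, τ y))
        ((ContinuousLinearMap.fst ℝ E K).prod (fderiv ℝ τ y)) y :=
      hasFDerivAt_fst.prodMk ((hτ y hyV).differentiableAt (by simp)).hasFDerivAt
    refine h1.congr_of_eventuallyEq ?_
    filter_upwards [hV.mem_nhds hyV] with y' hy'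
    refine Prod.ext ?_ rfl
    have h2 := he (e.symm (y', 0))
    rw [e.right_inv hy'] at h2
    exact (congrArg (fun w => w.1.1) h2).symm
  have hhd : HasFDerivAt h (fderiv ℝ h (x, p)) (e.symm (y, 0)) := by
    rw [hsymm]
    exact (hxsm.differentiableAt (by simp)).hasFDerivAt
  have hzero : HasFDerivAt (fun y : E × K => h (e.symm (y, 0))) (0 : E × K →L[ℝ] Q) y := by
    refine (hasFDerivAt_const (0 : Q) y).congr_of_eventuallyEq ?_
    filter_upwards [hV.mem_nhds hyV] with y' hy'
    have h2 := he (e.symm (y', 0))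
    rw [e.right_inv hy'] at h2
    exact (congrArg Prod.snd h2).symm
  have hchain := (HasFDerivAt.comp y hhd hσ).unique hzero
  -- Differentiating h = 0 along the zero set gives dh(a₁, dτ a) = 0. If dh(0, p') = q and dτ a =
  -- p', then dh(-a₁, 0) = q.
  intro q
  obtain ⟨p', hp'⟩ := hxsub q
  obtain ⟨a, ha⟩ := hsurj p'
  have h5 : fderiv ℝ h (x, p) (a.1, fderiv ℝ τ y a) = 0 := DFunLike.congr_fun hchain a
  have hp'' : fderiv ℝ h (x, p) (0, p') = q := hp'
  refine ⟨-a.1, ?_⟩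
  have h6 : ((-a.1, 0) : E × P) = (0, p') - (a.1, fderiv ℝ τ y a) := by
    rw [ha]
    simp
  change fderiv ℝ h (x, p) (-a.1, 0) = q
  rw [h6, map_sub, h5, hp'', sub_zero]

theorem OpenPartialHomeomorph.surjective_fderiv_of_contDiffAt {W W' : Type*}
    [NormedAddCommGroup W] [NormedSpace ℝ W] [NormedAddCommGroup W'] [NormedSpace ℝ W']
    (e : OpenPartialHomeomorph W W') (he : ContDiffOn ℝ ∞ e e.source)
    (he' : ContDiffOn ℝ ∞ e.symm e.target) {j : W} (hj : j ∈ e.source) :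
    Function.Surjective (fderiv ℝ e j) := by
  have h6 : HasFDerivAt e.symm (fderiv ℝ e.symm (e j)) (e j) :=
    ((he'.contDiffAt (e.open_target.mem_nhds (e.map_source hj))).differentiableAt
      (by simp)).hasFDerivAt
  have h7 : HasFDerivAt e (fderiv ℝ e j) (e.symm (e j)) := by
    rw [e.left_inv hj]
    exact ((he.contDiffAt (e.open_source.mem_nhds hj)).differentiableAt (by simp)).hasFDerivAt
  have h8 : HasFDerivAt (fun y => e (e.symm y)) (ContinuousLinearMap.id ℝ W') (e j) := by
    refine (hasFDerivAt_id _).congr_of_eventuallyEq ?_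
    filter_upwards [e.open_target.mem_nhds (e.map_source hj)] with y hy
    exact e.right_inv hy
  intro y
  exact ⟨fderiv ℝ e.symm (e j) y,
    DFunLike.congr_fun ((HasFDerivAt.comp _ h7 h6).unique h8) y⟩

/-- If `J` is a submersion in the parameter `p` near `(x₀, p₀)`, then, locally, `J (·, p)` is
transverse to the submanifold `e ⁻¹' S` for almost every `p`. -/
theorem exists_nhds_measure_not_transverse_eq_zero {W : Type u}
    [NormedAddCommGroup W] [NormedSpace ℝ W] [FiniteDimensional ℝ W]
    [MeasurableSpace P] [BorelSpace P] (μ : Measure P) [μ.IsAddHaarMeasure]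
    {J : E × P → W} {z₀ : E × P} (hJ : ∀ᶠ z in 𝓝 z₀, ContDiffAt ℝ ∞ J z)
    (hJsurj : Function.Surjective fun p => fderiv ℝ J z₀ (0, p))
    (e : OpenPartialHomeomorph W W)
    (he : ContDiffOn ℝ ∞ e e.source) (he' : ContDiffOn ℝ ∞ e.symm e.target)
    (S : Submodule ℝ W) (h0 : J z₀ ∈ e.source) :
    ∃ O ∈ 𝓝 z₀, μ {p | ∃ x, (x, p) ∈ O ∧ J (x, p) ∈ e.source ∧ e (J (x, p)) ∈ S ∧
      LinearMap.range (fderiv ℝ (fun x => e (J (x, p))) x).toLinearMap ⊔ S ≠ ⊤} = 0 := by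
  obtain ⟨T, hT⟩ := S.exists_isCompl
  -- The projection c has kernel S, so meeting S becomes the equation c(e(J)) = 0, and
  -- transversality to S becomes regularity of its solutions.
  let c : W →L[ℝ] T := LinearMap.toContinuousLinearMap (T.projectionOnto S hT.symm)
  have hcr : Function.Surjective c := Submodule.projectionOnto_surjective hT.symm
  have hcS : ∀ j, c j = 0 ↔ j ∈ S := fun j => Submodule.projectionOnto_apply_eq_zero_iff hT.symm
  have hJs : ∀ᶠ z in 𝓝 z₀, ContDiffAt ℝ ∞ J z ∧ J z ∈ e.source :=
    hJ.and (hJ.self_of_nhds.continuousAt.eventually_mem (e.open_source.mem_nhds h0))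
  have hed : ∀ j ∈ e.source, ContDiffAt ℝ ∞ e j := fun j hj =>
    he.contDiffAt (e.open_source.mem_nhds hj)
  have hh : ∀ᶠ z in 𝓝 z₀, ContDiffAt ℝ ∞ (fun z => c (e (J z))) z := by
    filter_upwards [hJs] with z hz
    exact c.contDiff.contDiffAt.comp z ((hed _ hz.2).comp z hz.1)
  have hfd : ∀ z, ContDiffAt ℝ ∞ J z → J z ∈ e.source →
      fderiv ℝ (fun z => c (e (J z))) z = c.comp ((fderiv ℝ e (J z)).comp (fderiv ℝ J z)) := by
    intro z hz hze
    have h1 : HasFDerivAt (fun z => e (J z)) ((fderiv ℝ e (J z)).comp (fderiv ℝ J z)) z :=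
      HasFDerivAt.comp z ((hed _ hze).differentiableAt (by simp)).hasFDerivAt
        (hz.differentiableAt (by simp)).hasFDerivAt
    exact (c.hasFDerivAt.comp z h1).fderiv
  have hs : Function.Surjective fun p => fderiv ℝ (fun z => c (e (J z))) z₀ (0, p) := by
    intro q
    obtain ⟨j, rfl⟩ := hcr q
    obtain ⟨k, rfl⟩ := e.surjective_fderiv_of_contDiffAt he he' h0 j
    obtain ⟨p, hp⟩ := hJsurj k
    refine ⟨p, ?_⟩
    rw [← hp, hfd z₀ hJ.self_of_nhds h0]
    rfl
  obtain ⟨O, hO, hμ⟩ := exists_nhds_measure_not_regular_eq_zero μ hh hs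
  refine ⟨_, Filter.inter_mem hO hJs, measure_mono_null ?_ hμ⟩
  rintro p ⟨x, ⟨hxO, hxJ, hxe⟩, -, hxS, hxt⟩
  refine ⟨x, hxO, (hcS _).2 hxS, fun hsurj => hxt ?_⟩
  have hJx : HasFDerivAt (fun x => J (x, p))
      ((fderiv ℝ J (x, p)).comp (ContinuousLinearMap.inl ℝ E P)) x :=
    HasFDerivAt.comp (f := fun x => (x, p)) x (hxJ.differentiableAt (by simp)).hasFDerivAt
      ((hasFDerivAt_id x).prodMk (hasFDerivAt_const p x))
  have h1 : fderiv ℝ (fun x => e (J (x, p))) x =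
      (fderiv ℝ e (J (x, p))).comp ((fderiv ℝ J (x, p)).comp (ContinuousLinearMap.inl ℝ E P)) :=
    (HasFDerivAt.comp x ((hed _ hxe).differentiableAt (by simp)).hasFDerivAt hJx).fderiv
  rw [eq_top_iff]
  intro j _
  obtain ⟨v, hv⟩ := hsurj (c j)
  have hv' : c (fderiv ℝ (fun x => e (J (x, p))) x v) = c j := by
    rw [h1, ← hv, hfd _ hxJ hxe]
    rfl
  refine Submodule.mem_sup.2 ⟨_, ⟨v, rfl⟩, j - fderiv ℝ (fun x => e (J (x, p))) x v, ?_, ?_⟩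
  · rw [← hcS, map_sub, hv', sub_self]
  · exact add_sub_cancel _ _

/-- Almost every member of a family `x ↦ a x + ρ p ∘ b x` of maps into a space of linear maps, with
`b x` injective and `ρ` onto, is transverse to a given submanifold, locally in `(x, p)`. -/
theorem exists_nhds_measure_affine_not_transverse_eq_zero {Y Z : Type u}
    [NormedAddCommGroup Y] [NormedSpace ℝ Y] [FiniteDimensional ℝ Y]
    [NormedAddCommGroup Z] [NormedSpace ℝ Z] [FiniteDimensional ℝ Z]
    [MeasurableSpace P] [BorelSpace P] (μ : Measure P) [μ.IsAddHaarMeasure]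
    (ρ : P →L[ℝ] (Y →L[ℝ] Z)) (hρ : Function.Surjective ρ)
    {a : E → E →L[ℝ] Z} {b : E → E →L[ℝ] Y} {x₀ : E} {p₀ : P}
    (ha : ∀ᶠ x in 𝓝 x₀, ContDiffAt ℝ ∞ a x) (hb : ∀ᶠ x in 𝓝 x₀, ContDiffAt ℝ ∞ b x)
    (hb0 : Function.Injective (b x₀))
    (e : OpenPartialHomeomorph (E →L[ℝ] Z) (E →L[ℝ] Z))
    (he : ContDiffOn ℝ ∞ e e.source) (he' : ContDiffOn ℝ ∞ e.symm e.target)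
    (S : Submodule ℝ (E →L[ℝ] Z)) (h0 : a x₀ + (ρ p₀).comp (b x₀) ∈ e.source) :
    ∃ O ∈ 𝓝 (x₀, p₀), μ {p | ∃ x, (x, p) ∈ O ∧ a x + (ρ p).comp (b x) ∈ e.source ∧
      e (a x + (ρ p).comp (b x)) ∈ S ∧
      LinearMap.range (fderiv ℝ (fun x => e (a x + (ρ p).comp (b x))) x).toLinearMap ⊔ S ≠ ⊤}
        = 0 := by
  let J : E × P → E →L[ℝ] Z := fun z => a z.1 + (ρ z.2).comp (b z.1)
  have hJ : ∀ᶠ z in 𝓝 (x₀, p₀), ContDiffAt ℝ ∞ J z := by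
    have h1 : Filter.Tendsto Prod.fst (𝓝 (x₀, p₀)) (𝓝 x₀) := continuous_fst.continuousAt
    filter_upwards [h1.eventually ha, h1.eventually hb] with z h2 h3
    exact (h2.comp z contDiffAt_fst).add
      ((ρ.contDiff.contDiffAt.comp z contDiffAt_snd).clm_comp (h3.comp z contDiffAt_fst))
  refine exists_nhds_measure_not_transverse_eq_zero μ (J := J) hJ ?_ e he he' S h0
  intro B
  -- With L a left inverse of b(x₀), any B equals (B ∘ L) ∘ b(x₀), and ρ attains B ∘ L.
  obtain ⟨L, hL⟩ := (b x₀ : E →ₗ[ℝ] Y).exists_leftInverse_of_injective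
    (LinearMap.ker_eq_bot.2 hb0)
  obtain ⟨p, hp⟩ := hρ (B.comp (LinearMap.toContinuousLinearMap L))
  have h3 : HasFDerivAt (fun p : P => J (x₀, p))
      ((fderiv ℝ J (x₀, p₀)).comp (ContinuousLinearMap.inr ℝ E P)) p₀ :=
    HasFDerivAt.comp (f := fun p => (x₀, p)) p₀
      (hJ.self_of_nhds.differentiableAt (by simp)).hasFDerivAt
      ((hasFDerivAt_const x₀ p₀).prodMk (hasFDerivAt_id p₀))
  have h4 : HasFDerivAt (fun p : P => J (x₀, p))
      (((ContinuousLinearMap.compL ℝ E Y Z).flip (b x₀)).comp ρ) p₀ :=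
    (((ContinuousLinearMap.compL ℝ E Y Z).flip (b x₀)).comp ρ).hasFDerivAt.const_add (a x₀)
  have h2 : fderiv ℝ J (x₀, p₀) (0, p) = (ρ p).comp (b x₀) :=
    DFunLike.congr_fun (h3.unique h4) p
  refine ⟨p, h2.trans ?_⟩
  rw [hp]
  ext v
  change B (L (b x₀ v)) = B v
  rw [show L (b x₀ v) = v from LinearMap.congr_fun hL v]

end ParametricTransversality

/-! ### Charts of the jet bundle and invariance -/

section JetCharts

variable {n l : ℕ}

/-- The jet A is represented by the linear germ A itself; take H the identity and h = L⁻¹. -/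
theorem IsA1Invariant.comp_mem {X : Set (JetSpace n l)} (hX : IsA1Invariant X) {A : JetSpace n l}
    (hA : A ∈ X) (L : EuclideanSpace ℝ (Fin n) ≃L[ℝ] EuclideanSpace ℝ (Fin n)) :
    A.comp (L : EuclideanSpace ℝ (Fin n) →L[ℝ] EuclideanSpace ℝ (Fin n)) ∈ X := by
  have h := hX A (OpenPartialHomeomorph.refl _) L.symm.toHomeomorph.toOpenPartialHomeomorph
    (Filter.Eventually.of_forall fun x => A.contDiff.contDiffAt) (map_zero A)
    ⟨trivial, rfl, contDiffOn_id, contDiffOn_id⟩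
    ⟨trivial, map_zero L.symm, L.symm.contDiff.contDiffOn, L.contDiff.contDiffOn⟩
    (by rwa [A.fderiv])
  have h2 : HasFDerivAt (A ∘ L)
      (A.comp (L : EuclideanSpace ℝ (Fin n) →L[ℝ] EuclideanSpace ℝ (Fin n))) 0 :=
    A.hasFDerivAt.comp _ L.hasFDerivAt
  have h3 := h2.fderiv
  rw [← h3]
  exact h

variable {N : Type*} [TopologicalSpace N] [ChartedSpace (EuclideanSpace ℝ (Fin n)) N]
  [IsManifold (𝓡 n) ∞ N]

/-- The fibre coordinate of a 1-jet in the chart of the jet bundle given by `φ`. -/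
noncomputable def jetFibreCoord (φ : OpenPartialHomeomorph N (EuclideanSpace ℝ (Fin n))) (j : JetBundle n l N) :
    JetSpace n l :=
  (jetCoord φ j).2.2

/-- Here L is the differential of the transition map φ ∘ ψ⁻¹ at ψ(q); it depends on q but not on the
jet over q. -/
theorem exists_jetFibreCoord_eq_comp {φ ψ : OpenPartialHomeomorph N (EuclideanSpace ℝ (Fin n))}
    (hφ : φ ∈ atlas (EuclideanSpace ℝ (Fin n)) N) (hψ : ψ ∈ atlas (EuclideanSpace ℝ (Fin n)) N)
    (q : N) (hqφ : q ∈ φ.source) (hqψ : q ∈ ψ.source) :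
    ∃ L : EuclideanSpace ℝ (Fin n) ≃L[ℝ] EuclideanSpace ℝ (Fin n),
      ∀ j : JetBundle n l N, j.2.proj = q → jetFibreCoord ψ j = (jetFibreCoord φ j).comp
        (L : EuclideanSpace ℝ (Fin n) →L[ℝ] EuclideanSpace ℝ (Fin n)) := by
  have : IsManifold (𝓡 n) 1 N := .of_le (n := ∞) (by exact_mod_cast le_top)
  have hmφ := mdifferentiable_of_mem_atlas (I := 𝓡 n) hφ
  have hmψ := mdifferentiable_of_mem_atlas (I := 𝓡 n) hψ
  let Lφ : EuclideanSpace ℝ (Fin n) ≃L[ℝ] EuclideanSpace ℝ (Fin n) := hmφ.mfderiv hqφ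
  let Lψ : EuclideanSpace ℝ (Fin n) ≃L[ℝ] EuclideanSpace ℝ (Fin n) := hmψ.mfderiv hqψ
  refine ⟨Lψ.symm.trans Lφ, ?_⟩
  rintro ⟨y, q', A⟩ rfl
  have key : ∀ v : EuclideanSpace ℝ (Fin n), Lφ.symm (Lφ (Lψ.symm v)) = Lψ.symm v := fun v => by
    simp
  refine ContinuousLinearMap.ext fun v => ?_
  exact congrArg (A : EuclideanSpace ℝ (Fin n) →L[ℝ] EuclideanSpace ℝ (Fin l)) (key v).symm

/-- By invariance, membership in `X(N, ℝˡ)` can be tested in any chart of the atlas. -/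
theorem mem_subfibreBundle_iff {X : Set (JetSpace n l)} (hX : IsA1Invariant X)
    {φ : OpenPartialHomeomorph N (EuclideanSpace ℝ (Fin n))}
    (hφ : φ ∈ atlas (EuclideanSpace ℝ (Fin n)) N) {j : JetBundle n l N}
    (hj : j.2.proj ∈ φ.source) :
    j ∈ subfibreBundle N X ↔ jetFibreCoord φ j ∈ X := by
  constructor
  · intro h
    obtain ⟨ψ, hψ, hjψ, -, -, hX'⟩ := Set.mem_iUnion₂.1 h
    obtain ⟨L, hL⟩ := exists_jetFibreCoord_eq_comp (l := l) hψ hφ _ hjψ hj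
    rw [hL j rfl]
    exact hX.comp_mem hX' L
  · intro h
    exact Set.mem_iUnion₂.2 ⟨φ, hφ, hj, φ.map_source hj, trivial, h⟩

variable (l) in
/-- The chart of the jet bundle given by the preferred chart of `N` at `q₀`. -/
theorem exists_baseJetChart (q₀ : N) :
    ∃ e : OpenPartialHomeomorph (JetBundle n l N)
        (EuclideanSpace ℝ (Fin l) × EuclideanSpace ℝ (Fin n) × JetSpace n l),
      (∀ j, j ∈ e.source ↔ j.2.proj ∈ (chartAt (EuclideanSpace ℝ (Fin n)) q₀).source) ∧
      (∀ j ∈ e.source, e j = (j.1, chartAt (EuclideanSpace ℝ (Fin n)) q₀ j.2.proj,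
        jetFibreCoord (chartAt (EuclideanSpace ℝ (Fin n)) q₀) j)) ∧
      ContMDiffOn (jetModel n l)
        𝓘(ℝ, EuclideanSpace ℝ (Fin l) × EuclideanSpace ℝ (Fin n) × JetSpace n l) ∞ e e.source ∧
      ContMDiffOn 𝓘(ℝ, EuclideanSpace ℝ (Fin l) × EuclideanSpace ℝ (Fin n) × JetSpace n l)
        (jetModel n l) ∞ e.symm e.target := by
  have : IsManifold (𝓡 n) 1 N := .of_le (n := ∞) (by exact_mod_cast le_top)
  -- The value and fibre entries are arbitrary: the preferred chart at a point of the bundle depends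
  -- only on its base point.
  let p₀ : JetBundle n l N := (0, ⟨q₀, 0⟩)
  let e : OpenPartialHomeomorph (JetBundle n l N)
      (EuclideanSpace ℝ (Fin l) × EuclideanSpace ℝ (Fin n) × JetSpace n l) :=
    chartAt (ModelProd (EuclideanSpace ℝ (Fin l))
      (ModelProd (EuclideanSpace ℝ (Fin n)) (JetSpace n l))) p₀
  have hext : extChartAt (jetModel n l) p₀ = e.toPartialEquiv := by
    refine PartialEquiv.ext (fun _ => rfl) (fun _ => rfl) ?_
    change e.source ∩ e ⁻¹' _ = e.source
    refine Set.inter_eq_left.2 fun j _ => ?_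
    simp
  have hsrc : ∀ j, j ∈ e.source ↔ j.2.proj ∈ (chartAt (EuclideanSpace ℝ (Fin n)) q₀).source := by
    intro j
    change j ∈ (chartAt (ModelProd (EuclideanSpace ℝ (Fin l))
      (ModelProd (EuclideanSpace ℝ (Fin n)) (JetSpace n l))) p₀).source ↔ _
    rw [prodChartedSpace_chartAt, FiberBundle.chartedSpace_chartAt]
    constructor
    · rintro ⟨_, h, _⟩
      exact h.1
    · intro h
      exact ⟨trivial, ⟨h, trivial⟩, h, trivial⟩
  refine ⟨e, hsrc, ?_, ?_, ?_⟩
  · intro j hj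
    rw [hsrc] at hj
    change (chartAt (ModelProd (EuclideanSpace ℝ (Fin l))
      (ModelProd (EuclideanSpace ℝ (Fin n)) (JetSpace n l))) p₀) j = _
    rw [prodChartedSpace_chartAt, FiberBundle.chartedSpace_chartAt]
    refine Prod.ext rfl (Prod.ext rfl ?_)
    -- The trivialization of the Hom bundle composes with those of its two factors: the identity on
    -- the target side, and the differential of the inverse chart on the tangent side.
    change ((Bundle.Trivial.trivialization N (EuclideanSpace ℝ (Fin l))).continuousLinearMapAt ℝ
      j.2.proj).comp (ContinuousLinearMap.comp j.2.snd
        ((trivializationAt (EuclideanSpace ℝ (Fin n)) (TangentSpace (𝓡 n)) q₀).symmL ℝ j.2.proj)) = _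
    rw [Bundle.Trivial.continuousLinearMapAt_trivialization,
      TangentBundle.symmL_trivializationAt hj]
    rw [modelWithCornersSelf_coe, Set.range_id, mfderivWithin_univ]
    rfl
  · have := contMDiffOn_extChartAt (I := jetModel n l) (n := ∞) (x := p₀)
    rw [hext] at this
    exact this
  · have := contMDiffOn_extChartAt_symm (I := jetModel n l) (n := ∞) p₀
    rw [hext] at this
    exact this

end JetCharts

theorem Submodule.finrank_top_prod {V W : Type*} [AddCommGroup V] [Module ℝ V]
    [FiniteDimensional ℝ V] [AddCommGroup W] [Module ℝ W] [FiniteDimensional ℝ W]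
    (T : Submodule ℝ W) :
    Module.finrank ℝ ((⊤ : Submodule ℝ V).prod T) = Module.finrank ℝ V + Module.finrank ℝ T := by
  have h1 : LinearMap.range ((LinearMap.id : V →ₗ[ℝ] V).prodMap T.subtype) =
      (⊤ : Submodule ℝ V).prod T := by
    rw [LinearMap.range_prodMap, LinearMap.range_id, Submodule.range_subtype]
  rw [← h1, LinearMap.finrank_range_of_inj (Function.injective_id.prodMap T.injective_subtype),
    Module.finrank_prod]

/-! ### X(N, ℝˡ) is a submanifold -/

section JetSubmanifold

variable {n l : ℕ} {N : Type*} [TopologicalSpace N] [ChartedSpace (EuclideanSpace ℝ (Fin n)) N]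
  [IsManifold (𝓡 n) ∞ N]

/-- A chart of the jet bundle, built from a preferred chart of `N` and a chart `eX` of `J¹(n, l)`,
which straightens `X(N, ℝˡ)` when `eX` straightens `X`. -/
theorem exists_jetChart (q₀ : N) (eX : OpenPartialHomeomorph (JetSpace n l) (JetSpace n l))
    (heX : ContDiffOn ℝ ∞ eX eX.source) (heX' : ContDiffOn ℝ ∞ eX.symm eX.target) :
    ∃ e : OpenPartialHomeomorph (JetBundle n l N)
        (EuclideanSpace ℝ (Fin l) × EuclideanSpace ℝ (Fin n) × JetSpace n l),
      (∀ j, j ∈ e.source ↔ j.2.proj ∈ (chartAt (EuclideanSpace ℝ (Fin n)) q₀).source ∧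
        jetFibreCoord (chartAt (EuclideanSpace ℝ (Fin n)) q₀) j ∈ eX.source) ∧
      (∀ j ∈ e.source, e j = (j.1, chartAt (EuclideanSpace ℝ (Fin n)) q₀ j.2.proj,
        eX (jetFibreCoord (chartAt (EuclideanSpace ℝ (Fin n)) q₀) j))) ∧
      ContMDiffOn (jetModel n l)
        𝓘(ℝ, EuclideanSpace ℝ (Fin l) × EuclideanSpace ℝ (Fin n) × JetSpace n l) ∞ e e.source ∧
      ContMDiffOn 𝓘(ℝ, EuclideanSpace ℝ (Fin l) × EuclideanSpace ℝ (Fin n) × JetSpace n l)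
        (jetModel n l) ∞ e.symm e.target := by
  obtain ⟨e₀, hs, he, hsm, hsm'⟩ := exists_baseJetChart (n := n) l q₀
  let G := (OpenPartialHomeomorph.refl (EuclideanSpace ℝ (Fin l))).prod
    ((OpenPartialHomeomorph.refl (EuclideanSpace ℝ (Fin n))).prod eX)
  have hG : ContDiffOn ℝ ∞ G G.source :=
    contDiffOn_fst.prodMk ((contDiff_fst.comp contDiff_snd).contDiffOn.prodMk
      (heX.comp (contDiff_snd.comp contDiff_snd).contDiffOn fun z hz => hz.2.2))
  have hG' : ContDiffOn ℝ ∞ G.symm G.target :=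
    contDiffOn_fst.prodMk ((contDiff_fst.comp contDiff_snd).contDiffOn.prodMk
      (heX'.comp (contDiff_snd.comp contDiff_snd).contDiffOn fun z hz => hz.2.2))
  have hsrc : ∀ j, j ∈ (e₀ ≫ₕ G).source ↔
      j.2.proj ∈ (chartAt (EuclideanSpace ℝ (Fin n)) q₀).source ∧
        jetFibreCoord (chartAt (EuclideanSpace ℝ (Fin n)) q₀) j ∈ eX.source := by
    intro j
    rw [OpenPartialHomeomorph.trans_source]
    constructor
    · rintro ⟨h1, -, -, h2⟩
      rw [he j h1] at h2
      exact ⟨(hs j).1 h1, h2⟩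
    · rintro ⟨h1, h2⟩
      refine ⟨(hs j).2 h1, trivial, trivial, ?_⟩
      rw [he j ((hs j).2 h1)]
      exact h2
  refine ⟨e₀ ≫ₕ G, hsrc, ?_, ?_, ?_⟩
  · intro j hj
    have h1 := (hs j).2 ((hsrc j).1 hj).1
    change G (e₀ j) = _
    rw [he j h1]
    rfl
  · exact hG.contMDiffOn.comp (hsm.mono fun j hj => hj.1) fun j hj => hj.2
  · exact hsm'.comp (hG'.contMDiffOn.mono fun j hj => hj.1) fun j hj => hj.2

theorem mem_subfibreBundle_iff_jetChart {X : Set (JetSpace n l)} (hX : IsA1Invariant X) {q₀ : N}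
    {eX : OpenPartialHomeomorph (JetSpace n l) (JetSpace n l)} {S : Submodule ℝ (JetSpace n l)}
    (hS : ∀ A ∈ eX.source, (A ∈ X ↔ eX A ∈ S)) {j : JetBundle n l N}
    (hj : j.2.proj ∈ (chartAt (EuclideanSpace ℝ (Fin n)) q₀).source)
    (hj' : jetFibreCoord (chartAt (EuclideanSpace ℝ (Fin n)) q₀) j ∈ eX.source) :
    j ∈ subfibreBundle N X ↔
      eX (jetFibreCoord (chartAt (EuclideanSpace ℝ (Fin n)) q₀) j) ∈ S := by
  rw [mem_subfibreBundle_iff hX (chart_mem_atlas _ q₀) hj, hS _ hj']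

/-- Straightening X in the fibre coordinate straightens X(N, ℝˡ) to ℝˡ × ℝⁿ × S, since invariance
lets one chart of `N` decide membership. -/
theorem isSubmanifold_subfibreBundle {d : ℕ} {X : Set (JetSpace n l)}
    (hXsub : IsSubmanifold 𝓘(ℝ, JetSpace n l) d X) (hXinv : IsA1Invariant X) :
    IsSubmanifold (jetModel n l) (n + l + d) (subfibreBundle N X) := by
  intro p hp
  have hps : p.2.proj ∈ (chartAt (EuclideanSpace ℝ (Fin n)) p.2.proj).source :=
    mem_chart_source _ _
  have hpX := (mem_subfibreBundle_iff hXinv (chart_mem_atlas _ p.2.proj) hps).1 hp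
  obtain ⟨eX, hpe, heX, heX', S, hSd, hS⟩ := hXsub _ hpX
  obtain ⟨e, hsrc, he, hsm, hsm'⟩ := exists_jetChart p.2.proj eX heX.contDiffOn heX'.contDiffOn
  refine ⟨e, (hsrc p).2 ⟨hps, hpe⟩, hsm, hsm', (⊤ : Submodule ℝ _).prod
    ((⊤ : Submodule ℝ _).prod S), ?_, fun j hj => ?_⟩
  · rw [Submodule.finrank_top_prod, Submodule.finrank_top_prod, hSd]
    simp
    ring
  · rw [mem_subfibreBundle_iff_jetChart hXinv hS ((hsrc j).1 hj).1 ((hsrc j).1 hj).2, he j hj]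
    simp

end JetSubmanifold

/-! ### Transversality in a straightening chart -/

section ChartTransversality

variable {E H M E' H' P : Type*}
  [NormedAddCommGroup E] [NormedSpace ℝ E] [TopologicalSpace H]
  [TopologicalSpace M] [ChartedSpace H M]
  [NormedAddCommGroup E'] [NormedSpace ℝ E'] [TopologicalSpace H']
  [TopologicalSpace P] [ChartedSpace H' P] {I : ModelWithCorners ℝ E H}
  {J : ModelWithCorners ℝ E' H'}

/-- In a chart straightening `W`, the linear subspace is contained in the tangent space of `W`. -/
theorem mfderiv_symm_mem_submanifoldTangentSpace {W : Set P} {e : OpenPartialHomeomorph P E'}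
    (he' : ContMDiffOn 𝓘(ℝ, E') J ∞ e.symm e.target) {S : Submodule ℝ E'}
    (hS : ∀ x ∈ e.source, (x ∈ W ↔ e x ∈ S)) {p : P} (hp : p ∈ e.source) (hpW : p ∈ W)
    {s : E'} (hs : s ∈ S) :
    (mfderiv 𝓘(ℝ, E') J e.symm (e p) s : E') ∈
      (submanifoldTangentSpace J W p : Submodule ℝ E') := by
  -- The line through e(p) in the direction s stays in S, so its preimage is a curve in W for small
  -- t.
  refine Submodule.subset_span ⟨fun t : ℝ => e.symm (e p + t • s), ?_, ?_, ?_⟩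
  · simp [e.left_inv hp]
  · have hc : Filter.Tendsto (fun t : ℝ => e p + t • s) (𝓝 0) (𝓝 (e p)) := by
      have : Continuous fun t : ℝ => e p + t • s := by fun_prop
      simpa using this.tendsto 0
    filter_upwards [hc.eventually_mem (e.open_target.mem_nhds (e.map_source hp))] with t ht
    refine ⟨?_, ?_⟩
    · refine ContMDiffAt.comp (I' := 𝓘(ℝ, E')) t (he'.contMDiffAt (e.open_target.mem_nhds ht)) ?_
      have : ContDiff ℝ ∞ fun t : ℝ => e p + t • s := by fun_prop
      exact this.contDiffAt.contMDiffAt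
    · rw [hS _ (e.map_target ht), e.right_inv ht]
      exact S.add_mem ((hS p hp).1 hpW) (S.smul_mem t hs)
  · have h1 : HasFDerivAt (fun t : ℝ => e p + t • s) (ContinuousLinearMap.toSpanSingleton ℝ s) 0 :=
      (ContinuousLinearMap.toSpanSingleton ℝ s).hasFDerivAt.const_add (e p)
    have h0 : e p + (0 : ℝ) • s = e p := by simp
    have hd : MDifferentiableAt 𝓘(ℝ, E') J e.symm (e p) :=
      (he'.contMDiffAt (e.open_target.mem_nhds (e.map_source hp))).mdifferentiableAt (by simp)
    have h2 : HasMFDerivAt 𝓘(ℝ, E') J e.symm (e p + (0 : ℝ) • s)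
        (mfderiv 𝓘(ℝ, E') J e.symm (e p + (0 : ℝ) • s)) := by
      rw [h0]
      exact hd.hasMFDerivAt
    have h3 := (HasMFDerivAt.comp (I' := 𝓘(ℝ, E')) (0 : ℝ) h2 h1.hasMFDerivAt).mfderiv
    let D : E' → (E' →L[ℝ] E') := fun y => mfderiv 𝓘(ℝ, E') J e.symm y
    have h4 : D (e p + (0 : ℝ) • s) ((1 : ℝ) • s) = D (e p) s := by rw [h0, one_smul]
    refine Eq.trans ?_ h4
    exact congrArg (fun T : ℝ →L[ℝ] E' => T 1) h3

/-- Transversality can be checked in a chart straightening the submanifold. -/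
theorem range_mfderiv_sup_submanifoldTangentSpace_eq_top {W : Set P}
    {e : OpenPartialHomeomorph P E'} (he : ContMDiffOn J 𝓘(ℝ, E') ∞ e e.source)
    (he' : ContMDiffOn 𝓘(ℝ, E') J ∞ e.symm e.target) {S : Submodule ℝ E'}
    (hS : ∀ x ∈ e.source, (x ∈ W ↔ e x ∈ S)) {g : M → P} {q : M} (hq : g q ∈ e.source)
    (hqW : g q ∈ W) {ξ : M → E'} {ξ' : E →L[ℝ] E'} (hξ : HasMFDerivAt I 𝓘(ℝ, E') ξ q ξ')
    (hg : g =ᶠ[𝓝 q] e.symm ∘ ξ) (hξq : ξ q = e (g q))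
    (htop : LinearMap.range ξ'.toLinearMap ⊔ S = ⊤) :
    LinearMap.range (mfderiv I J g q).toLinearMap ⊔ submanifoldTangentSpace J W (g q) = ⊤ := by
  have hd' : MDifferentiableAt 𝓘(ℝ, E') J e.symm (e (g q)) :=
    (he'.contMDiffAt (e.open_target.mem_nhds (e.map_source hq))).mdifferentiableAt (by simp)
  have hd : MDifferentiableAt J 𝓘(ℝ, E') e (g q) :=
    (he.contMDiffAt (e.open_source.mem_nhds hq)).mdifferentiableAt (by simp)
  let D : E' →L[ℝ] E' := mfderiv 𝓘(ℝ, E') J e.symm (e (g q))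
  let G : E →L[ℝ] E' := mfderiv I J g q
  let T : Submodule ℝ E' := submanifoldTangentSpace J W (g q)
  have hG : G = D.comp ξ' := by
    have h1 : HasMFDerivAt 𝓘(ℝ, E') J e.symm (ξ q) D := by
      rw [hξq]
      exact hd'.hasMFDerivAt
    exact ((h1.comp q hξ).congr_of_eventuallyEq hg).mfderiv
  have hDs : Function.Surjective D := by
    intro v
    let D₁ : E' →L[ℝ] E' := mfderiv J 𝓘(ℝ, E') e (g q)
    refine ⟨D₁ v, ?_⟩
    have h2 : HasMFDerivAt J J (e.symm ∘ e) (g q) (D.comp D₁) :=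
      hd'.hasMFDerivAt.comp (g q) hd.hasMFDerivAt
    have h3 : HasMFDerivAt J J (e.symm ∘ e) (g q) (ContinuousLinearMap.id ℝ E') := by
      refine (hasMFDerivAt_id (I := J) (g q)).congr_of_eventuallyEq ?_
      filter_upwards [e.open_source.mem_nhds hq] with x hx
      exact e.left_inv hx
    exact DFunLike.congr_fun (hasMFDerivAt_unique h2 h3) v
  change LinearMap.range G.toLinearMap ⊔ T = ⊤
  rw [eq_top_iff]
  -- Decompose a preimage of v in the chart and push both parts forward by D. Only the inclusion of
  -- D(S) in the tangent space is needed, not equality.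
  intro v _
  obtain ⟨u, rfl⟩ := hDs v
  obtain ⟨_, ⟨w, rfl⟩, s, hs, hws⟩ := Submodule.mem_sup.1 (htop.symm ▸ Submodule.mem_top : u ∈ _)
  refine Submodule.mem_sup.2 ⟨G w, ⟨w, rfl⟩, D s,
    mfderiv_symm_mem_submanifoldTangentSpace he' hS hq hqW hs, ?_⟩
  rw [hG, ← hws]
  exact (map_add D _ _).symm

end ChartTransversality

/-! ### Transversality of jet extensions -/

section JetTransversality

variable {n l : ℕ} {N : Type*} [TopologicalSpace N] [ChartedSpace (EuclideanSpace ℝ (Fin n)) N]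
  [IsManifold (𝓡 n) ∞ N]

theorem contDiffAt_comp_chartAt_symm {Z : Type*} [NormedAddCommGroup Z] [NormedSpace ℝ Z]
    {G : N → Z} (hG : ContMDiff (𝓡 n) 𝓘(ℝ, Z) ∞ G) (q₀ : N) {x : EuclideanSpace ℝ (Fin n)}
    (hx : x ∈ (chartAt (EuclideanSpace ℝ (Fin n)) q₀).target) :
    ContDiffAt ℝ ∞ (G ∘ (chartAt (EuclideanSpace ℝ (Fin n)) q₀).symm) x := by
  rw [← contMDiffAt_iff_contDiffAt]
  exact hG.contMDiffAt.comp x ((contMDiffOn_chart_symm (I := 𝓡 n)).contMDiffAt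
    ((chartAt (EuclideanSpace ℝ (Fin n)) q₀).open_target.mem_nhds hx))

theorem fderiv_comp_chartAt_symm {Z : Type*} [NormedAddCommGroup Z] [NormedSpace ℝ Z]
    {G : N → Z} (hG : ContMDiff (𝓡 n) 𝓘(ℝ, Z) ∞ G) (q₀ : N) {q : N}
    (hq : q ∈ (chartAt (EuclideanSpace ℝ (Fin n)) q₀).source) :
    fderiv ℝ (G ∘ (chartAt (EuclideanSpace ℝ (Fin n)) q₀).symm)
        (chartAt (EuclideanSpace ℝ (Fin n)) q₀ q) =
      ContinuousLinearMap.comp (mfderiv (𝓡 n) 𝓘(ℝ, Z) G q : EuclideanSpace ℝ (Fin n) →L[ℝ] Z)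
        (mfderiv (𝓡 n) (𝓡 n) (chartAt (EuclideanSpace ℝ (Fin n)) q₀).symm
          (chartAt (EuclideanSpace ℝ (Fin n)) q₀ q) :
          EuclideanSpace ℝ (Fin n) →L[ℝ] EuclideanSpace ℝ (Fin n)) := by
  have : IsManifold (𝓡 n) 1 N := .of_le (n := ∞) (by exact_mod_cast le_top)
  set φ := chartAt (EuclideanSpace ℝ (Fin n)) q₀
  let D : EuclideanSpace ℝ (Fin n) →L[ℝ] Z := mfderiv (𝓡 n) 𝓘(ℝ, Z) G q
  have h1 : HasMFDerivAt (𝓡 n) 𝓘(ℝ, Z) G (φ.symm (φ q)) D := by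
    rw [φ.left_inv hq]
    exact (hG.mdifferentiableAt (by simp)).hasMFDerivAt
  let D' : EuclideanSpace ℝ (Fin n) →L[ℝ] EuclideanSpace ℝ (Fin n) :=
    mfderiv (𝓡 n) (𝓡 n) φ.symm (φ q)
  have h2 : HasMFDerivAt (𝓡 n) (𝓡 n) φ.symm (φ q) D' :=
    ((mdifferentiable_chart (I := 𝓡 n) q₀).mdifferentiableAt_symm (φ.map_source hq)).hasMFDerivAt
  have h3 : HasFDerivAt (G ∘ φ.symm) (D.comp D') (φ q) :=
    hasMFDerivAt_iff_hasFDerivAt.1 (h1.comp (φ q) h2)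
  exact h3.fderiv

theorem jetFibreCoord_jetExtension {G : N → EuclideanSpace ℝ (Fin l)}
    (hG : ContMDiff (𝓡 n) (𝓡 l) ∞ G) (q₀ : N) {q : N}
    (hq : q ∈ (chartAt (EuclideanSpace ℝ (Fin n)) q₀).source) :
    jetFibreCoord (chartAt (EuclideanSpace ℝ (Fin n)) q₀) (jetExtension G q : JetBundle n l N) =
      fderiv ℝ (G ∘ (chartAt (EuclideanSpace ℝ (Fin n)) q₀).symm)
        (chartAt (EuclideanSpace ℝ (Fin n)) q₀ q) :=
  (fderiv_comp_chartAt_symm hG q₀ hq).symm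

/-- Transversality of a jet extension to `X(N, ℝˡ)` follows from transversality to `X` of the
derivative in a chart. -/
theorem range_mfderiv_jetExtension_sup_eq_top {X : Set (JetSpace n l)} (hX : IsA1Invariant X)
    {q₀ : N} {eX : OpenPartialHomeomorph (JetSpace n l) (JetSpace n l)}
    (heX : ContDiffOn ℝ ∞ eX eX.source) (heX' : ContDiffOn ℝ ∞ eX.symm eX.target)
    {S : Submodule ℝ (JetSpace n l)} (hS : ∀ A ∈ eX.source, (A ∈ X ↔ eX A ∈ S))
    {G : N → EuclideanSpace ℝ (Fin l)} (hG : ContMDiff (𝓡 n) (𝓡 l) ∞ G) {q : N}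
    (hq : q ∈ (chartAt (EuclideanSpace ℝ (Fin n)) q₀).source)
    (hqX : fderiv ℝ (G ∘ (chartAt (EuclideanSpace ℝ (Fin n)) q₀).symm)
      (chartAt (EuclideanSpace ℝ (Fin n)) q₀ q) ∈ eX.source)
    (hqW : (jetExtension G q : JetBundle n l N) ∈ subfibreBundle N X)
    (htop : LinearMap.range (fderiv ℝ
      (fun x => eX (fderiv ℝ (G ∘ (chartAt (EuclideanSpace ℝ (Fin n)) q₀).symm) x))
      (chartAt (EuclideanSpace ℝ (Fin n)) q₀ q)).toLinearMap ⊔ S = ⊤) :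
    LinearMap.range (mfderiv (𝓡 n) (jetModel n l)
        (jetExtension G : N → JetBundle n l N) q).toLinearMap ⊔
      submanifoldTangentSpace (jetModel n l) (subfibreBundle N X) (jetExtension G q) = ⊤ := by
  have : IsManifold (𝓡 n) 1 N := .of_le (n := ∞) (by exact_mod_cast le_top)
  obtain ⟨e, hsrc, he, hsm, hsm'⟩ := exists_jetChart q₀ eX heX heX'
  have hcoord := fun q' hq' => jetFibreCoord_jetExtension (q := q') hG q₀ hq'
  have hcd := fun x hx => contDiffAt_comp_chartAt_symm (x := x) hG q₀ hx
  have hmφ := mdifferentiable_chart (I := 𝓡 n) q₀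
  set φ := chartAt (EuclideanSpace ℝ (Fin n)) q₀
  have hqt : φ q ∈ φ.target := φ.map_source hq
  let A : EuclideanSpace ℝ (Fin n) → JetSpace n l := fderiv ℝ (G ∘ φ.symm)
  have hA : ContDiffAt ℝ ∞ A (φ q) := (hcd _ hqt).fderiv_right (by simp)
  -- Expression of the jet extension in the chart e of the jet bundle: value, base point,
  -- straightened fibre coordinate.
  let Ξ : EuclideanSpace ℝ (Fin n) →
      EuclideanSpace ℝ (Fin l) × EuclideanSpace ℝ (Fin n) × JetSpace n l :=
    fun x => ((G ∘ φ.symm) x, x, eX (A x))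
  have heA : DifferentiableAt ℝ (fun x => eX (A x)) (φ q) :=
    (((heX.contDiffAt (eX.open_source.mem_nhds hqX)).differentiableAt (by simp)).comp (φ q)
      (hA.differentiableAt (by simp)))
  have hΞ : HasFDerivAt Ξ ((A (φ q)).prod ((ContinuousLinearMap.id ℝ _).prod
      (fderiv ℝ (fun x => eX (A x)) (φ q)))) (φ q) :=
    ((hcd _ hqt).differentiableAt (by simp)).hasFDerivAt.prodMk
      ((hasFDerivAt_id _).prodMk heA.hasFDerivAt)
  have hφ := (hmφ.mdifferentiableAt hq).hasMFDerivAt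
  have hjs : ∀ q', q' ∈ φ.source → A (φ q') ∈ eX.source →
      (jetExtension G q' : JetBundle n l N) ∈ e.source ∧
        e (jetExtension G q') = Ξ (φ q') := by
    intro q' h1 h2
    have h3 : (jetExtension G q' : JetBundle n l N) ∈ e.source := by
      rw [hsrc, hcoord q' h1]
      exact ⟨h1, h2⟩
    refine ⟨h3, ?_⟩
    rw [he _ h3, hcoord q' h1]
    refine Prod.ext ?_ rfl
    change G q' = G (φ.symm (φ q'))
    rw [φ.left_inv h1]
  obtain ⟨hjq, hjΞ⟩ := hjs q hq hqX
  have hSS : ∀ j ∈ e.source, (j ∈ subfibreBundle N X ↔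
      e j ∈ (⊤ : Submodule ℝ (EuclideanSpace ℝ (Fin l))).prod
        ((⊤ : Submodule ℝ (EuclideanSpace ℝ (Fin n))).prod S)) := by
    intro j hj
    rw [mem_subfibreBundle_iff_jetChart hX hS ((hsrc j).1 hj).1 ((hsrc j).1 hj).2, he j hj]
    simp [φ]
  refine range_mfderiv_sup_submanifoldTangentSpace_eq_top hsm hsm' hSS hjq hqW
    (hΞ.hasMFDerivAt.comp q hφ) ?_ hjΞ.symm ?_
  · have hcont : ContinuousAt (fun q' => A (φ q')) q :=
      hA.continuousAt.comp (φ.continuousAt hq)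
    filter_upwards [φ.open_source.mem_nhds hq,
      hcont.eventually_mem (eX.open_source.mem_nhds hqX)] with q' h1 h2
    obtain ⟨h3, h4⟩ := hjs q' h1 h2
    change _ = e.symm (Ξ (φ q'))
    rw [← h4, e.left_inv h3]
  · rw [eq_top_iff]
    -- Only the fibre component j uses the hypothesis; the errors in the value and base components
    -- are absorbed by the two full factors.
    rintro ⟨y, x, j⟩ _
    obtain ⟨_, ⟨w, rfl⟩, s, hs, hws⟩ :=
      Submodule.mem_sup.1 (htop.symm ▸ Submodule.mem_top : j ∈ _)
    obtain ⟨v, hv⟩ := hmφ.mfderiv_surjective hq w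
    refine Submodule.mem_sup.2 ⟨_, ⟨v, rfl⟩, (y - A (φ q) w, x - w, s),
      ⟨trivial, trivial, hs⟩, ?_⟩
    have h5 : ((A (φ q)).prod ((ContinuousLinearMap.id ℝ _).prod
      (fderiv ℝ (fun x => eX (A x)) (φ q)))) w + (y - A (φ q) w, x - w, s) = (y, x, j) := by
      refine Prod.ext (add_sub_cancel _ _) (Prod.ext (add_sub_cancel _ _) hws)
    rw [← hv] at h5 ⊢
    exact h5

/-- Linear maps `ℝᵐ → ℝˡ`, parametrized by matrix entries. -/
noncomputable def matrixToCLM (m l : ℕ) : (Fin l → Fin m → ℝ) →L[ℝ]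
    (EuclideanSpace ℝ (Fin m) →L[ℝ] EuclideanSpace ℝ (Fin l)) :=
  LinearMap.toContinuousLinearMap
    ((LinearMap.toContinuousLinearMap (𝕜 := ℝ) (E := EuclideanSpace ℝ (Fin m))
      (F' := EuclideanSpace ℝ (Fin l))).toLinearMap ∘ₗ
      (Matrix.toEuclideanLin (𝕜 := ℝ) (m := Fin l) (n := Fin m)).toLinearMap ∘ₗ
      (Matrix.ofLinearEquiv ℝ).toLinearMap)

theorem matrixToCLM_apply {m l : ℕ} (a : Fin l → Fin m → ℝ) (v : EuclideanSpace ℝ (Fin m)) :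
    matrixToCLM m l a v = Matrix.toEuclideanLin (Matrix.of a) v := rfl

theorem matrixToCLM_surjective (m l : ℕ) : Function.Surjective (matrixToCLM m l) := by
  intro T
  obtain ⟨M, hM⟩ := (Matrix.toEuclideanLin (𝕜 := ℝ) (m := Fin l) (n := Fin m)).surjective
    (T : EuclideanSpace ℝ (Fin m) →ₗ[ℝ] EuclideanSpace ℝ (Fin l))
  refine ⟨fun i j => M i j, ContinuousLinearMap.ext fun v => ?_⟩
  rw [matrixToCLM_apply]
  exact LinearMap.congr_fun hM v

end JetTransversality

/-! ### The transversality theorem -/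

theorem theorem2p1 (n m l : ℕ) (hn : 0 < n) (hm : 0 < m) (hl : 0 < l)
    (N : Type*) [TopologicalSpace N] [T2Space N] [SecondCountableTopology N]
    [ChartedSpace (EuclideanSpace ℝ (Fin n)) N] [IsManifold (𝓡 n) ∞ N]
    (U : Set (EuclideanSpace ℝ (Fin m))) (hU : IsOpen U)
    (f : N → EuclideanSpace ℝ (Fin m)) (hfU : ∀ q, f q ∈ U)
    (hf : IsSmoothImmersion (𝓡 n) (𝓡 m) f)
    (F : EuclideanSpace ℝ (Fin m) → EuclideanSpace ℝ (Fin l)) (hF : ContDiffOn ℝ ∞ F U)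
    (d : ℕ) (X : Set (JetSpace n l))
    (hXsub : IsSubmanifold 𝓘(ℝ, JetSpace n l) d X) (hXinv : IsA1Invariant X) :
    IsSubmanifold (jetModel n l) (n + l + d) (subfibreBundle N X) ∧
    ∃ S : Set (EuclideanSpace ℝ (Fin m) →ₗ[ℝ] EuclideanSpace ℝ (Fin l)), IsLebesgueNull S ∧
      ∀ π : EuclideanSpace ℝ (Fin m) →ₗ[ℝ] EuclideanSpace ℝ (Fin l), π ∉ S →
        IsTransverseTo (𝓡 n) (jetModel n l)
          (jetExtension (fun q => F (f q) + π (f q))) (subfibreBundle N X) := by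
  refine ⟨isSubmanifold_subfibreBundle hXsub hXinv, ?_⟩
  have : IsManifold (𝓡 n) 1 N := .of_le (n := ∞) (by exact_mod_cast le_top)
  let G : (Fin l → Fin m → ℝ) → N → EuclideanSpace ℝ (Fin l) :=
    fun p q => F (f q) + Matrix.toEuclideanLin (Matrix.of p) (f q)
  have hFf : ContMDiff (𝓡 n) (𝓡 l) ∞ fun q => F (f q) := fun q =>
    ((hF.contDiffAt (hU.mem_nhds (hfU q))).contMDiffAt).comp q hf.1.contMDiffAt
  have hG : ∀ p, ContMDiff (𝓡 n) (𝓡 l) ∞ (G p) := fun p =>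
    hFf.add ((matrixToCLM m l p).contDiff.contMDiff.comp hf.1)
  -- Pairs (point, matrix) at which transversality fails. The exceptional matrices form the
  -- projection of B, which can be shown null locally on the product.
  let B : Set (N × (Fin l → Fin m → ℝ)) := {z |
    (jetExtension (G z.2) z.1 : JetBundle n l N) ∈ subfibreBundle N X ∧
    LinearMap.range (mfderiv (𝓡 n) (jetModel n l)
        (jetExtension (G z.2) : N → JetBundle n l N) z.1).toLinearMap ⊔
      submanifoldTangentSpace (jetModel n l) (subfibreBundle N X) (jetExtension (G z.2) z.1) ≠ ⊤}
  refine ⟨{π | ¬ IsTransverseTo (𝓡 n) (jetModel n l)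
    (jetExtension (fun q => F (f q) + π (f q))) (subfibreBundle N X)}, ?_,
    fun π hπ => not_not.1 hπ⟩
  have hB : MeasureTheory.volume (Prod.snd '' B) = 0 := by
    refine measure_image_eq_zero_of_locally ?_
    rintro ⟨q₀, p₀⟩ ⟨hW, -⟩
    have hq₀ := mem_chart_source (EuclideanSpace ℝ (Fin n)) q₀
    have hcoord : ∀ p q, q ∈ (chartAt (EuclideanSpace ℝ (Fin n)) q₀).source →
        jetFibreCoord (chartAt (EuclideanSpace ℝ (Fin n)) q₀)
          (jetExtension (G p) q : JetBundle n l N) = _ := fun p q hq =>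
      jetFibreCoord_jetExtension (hG p) q₀ hq
    have hcdF := fun x hx => contDiffAt_comp_chartAt_symm (x := x) hFf q₀ hx
    have hcdf := fun x hx => contDiffAt_comp_chartAt_symm (x := x) hf.1 q₀ hx
    have hdf := fderiv_comp_chartAt_symm hf.1 q₀ hq₀
    have hmφ := mdifferentiable_chart (I := 𝓡 n) q₀
    have hmemW := fun j hj => mem_subfibreBundle_iff (j := j) hXinv
      (chart_mem_atlas (EuclideanSpace ℝ (Fin n)) q₀) hj
    have htrans := fun eX heX heX' S hS p q => range_mfderiv_jetExtension_sup_eq_top (q := q)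
      (S := S) (q₀ := q₀) (eX := eX) hXinv heX heX' hS (hG p)
    set φ := chartAt (EuclideanSpace ℝ (Fin n)) q₀
    let a : EuclideanSpace ℝ (Fin n) → JetSpace n l := fderiv ℝ ((fun q => F (f q)) ∘ φ.symm)
    let b : EuclideanSpace ℝ (Fin n) → EuclideanSpace ℝ (Fin n) →L[ℝ] EuclideanSpace ℝ (Fin m) :=
      fderiv ℝ (f ∘ φ.symm)
    -- The fibre coordinate is affine in the matrix p because adding π to F adds π ∘ f.
    have hab : ∀ p, ∀ x ∈ φ.target,
        fderiv ℝ (G p ∘ φ.symm) x = a x + (matrixToCLM m l p).comp (b x) := by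
      intro p x hx
      have h1 := ((hcdF x hx).differentiableAt (by simp)).hasFDerivAt
      have h2 := ((hcdf x hx).differentiableAt (by simp)).hasFDerivAt
      exact (h1.add ((matrixToCLM m l p).hasFDerivAt.comp x h2)).fderiv
    have hx₀ : φ q₀ ∈ φ.target := φ.map_source hq₀
    have ha : ∀ᶠ x in 𝓝 (φ q₀), ContDiffAt ℝ ∞ a x := by
      filter_upwards [φ.open_target.mem_nhds hx₀] with x hx
      exact (hcdF x hx).fderiv_right (by simp)
    have hb : ∀ᶠ x in 𝓝 (φ q₀), ContDiffAt ℝ ∞ b x := by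
      filter_upwards [φ.open_target.mem_nhds hx₀] with x hx
      exact (hcdf x hx).fderiv_right (by simp)
    -- This is where the immersion hypothesis enters.
    have hb0 : Function.Injective (b (φ q₀)) := by
      change Function.Injective (fderiv ℝ (f ∘ φ.symm) (φ q₀))
      rw [hdf]
      exact (hf.2 q₀).comp (hmφ.symm.mfderiv_injective hx₀)
    have hX₀ : a (φ q₀) + (matrixToCLM m l p₀).comp (b (φ q₀)) ∈ X := by
      rw [← hab p₀ _ hx₀, ← hcoord p₀ q₀ hq₀]
      exact (hmemW _ hq₀).1 hW
    obtain ⟨eX, hpe, heX, heX', S, hSd, hS⟩ := hXsub _ hX₀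
    obtain ⟨O, hO, hμ⟩ := exists_nhds_measure_affine_not_transverse_eq_zero
      MeasureTheory.volume (matrixToCLM m l) (matrixToCLM_surjective m l) ha hb hb0 eX
      heX.contDiffOn heX'.contDiffOn S hpe
    have hJ : ContinuousAt (fun z : N × (Fin l → Fin m → ℝ) =>
        a (φ z.1) + (matrixToCLM m l z.2).comp (b (φ z.1))) (q₀, p₀) := by
      have h1 : ContinuousAt (fun z : N × (Fin l → Fin m → ℝ) => φ z.1) (q₀, p₀) :=
        ContinuousAt.comp (f := Prod.fst) (φ.continuousAt hq₀) continuousAt_fst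
      have h2 : ContinuousAt (fun z : N × (Fin l → Fin m → ℝ) => a (φ z.1)) (q₀, p₀) :=
        ContinuousAt.comp (g := a) ha.self_of_nhds.continuousAt h1
      have h3 : ContinuousAt (fun z : N × (Fin l → Fin m → ℝ) => b (φ z.1)) (q₀, p₀) :=
        ContinuousAt.comp (g := b) hb.self_of_nhds.continuousAt h1
      exact h2.add (((matrixToCLM m l).continuous.continuousAt.comp continuousAt_snd).clm_comp h3)
    have hφp : ContinuousAt (fun z : N × (Fin l → Fin m → ℝ) => (φ z.1, z.2)) (q₀, p₀) :=
      (ContinuousAt.comp (f := Prod.fst) (φ.continuousAt hq₀) continuousAt_fst).prodMk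
        continuousAt_snd
    -- The neighbourhood keeps q in the chart of `N`, (φ q, p) in O, and the fibre coordinate in the
    -- domain of the chart straightening X.
    refine ⟨_, Filter.inter_mem (continuousAt_fst.preimage_mem_nhds (φ.open_source.mem_nhds hq₀))
      (Filter.inter_mem (hφp.preimage_mem_nhds hO)
        (hJ.preimage_mem_nhds (eX.open_source.mem_nhds hpe))), measure_mono_null ?_ hμ⟩
    rintro _ ⟨⟨q, p⟩, ⟨⟨hqW, hqt⟩, hqs, hqO, hqe⟩, rfl⟩
    have hqs' : q ∈ φ.source := hqs
    have hxt : φ q ∈ φ.target := φ.map_source hqs'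
    have hqe' : a (φ q) + (matrixToCLM m l p).comp (b (φ q)) ∈ eX.source := hqe
    have hqW' : (jetExtension (G p) q : JetBundle n l N) ∈ subfibreBundle N X := hqW
    refine ⟨φ q, hqO, hqe', ?_, fun htop => hqt ?_⟩
    · rw [← hS _ hqe', ← hab p _ hxt, ← hcoord p q hqs']
      exact (hmemW _ hqs').1 hqW'
    · refine htrans eX heX.contDiffOn heX'.contDiffOn S hS p q hqs' ?_ hqW' ?_
      · rw [hab p _ hxt]
        exact hqe'
      · have hev : (fun x => eX (fderiv ℝ (G p ∘ φ.symm) x)) =ᶠ[𝓝 (φ q)]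
            fun x => eX (a x + (matrixToCLM m l p).comp (b x)) := by
          filter_upwards [φ.open_target.mem_nhds hxt] with x hx
          rw [hab p x hx]
        rw [hev.fderiv_eq]
        exact htop
  refine measure_mono_null ?_ hB
  intro p hp
  have hp' : ¬ IsTransverseTo (𝓡 n) (jetModel n l)
    (jetExtension (G p)) (subfibreBundle N X) := hp
  rw [IsTransverseTo] at hp'
  push Not at hp'
  obtain ⟨q, hqW, hqt⟩ := hp'
  exact ⟨(q, p), ⟨hqW, hqt⟩, rfl⟩
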